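/- Let $q$ be a prime power and $m\ge 2$ an even integer. For each point $P$ of the projective space $PG(m,q)$ fix a vector $r(P)\in\mathbb F_q^{m+1}\setminus\{0\}$ of homogeneous coordinates of $P$, and let $$PRM_q(2,m)=\{(f(r(P)))_{P\in PG(m,q)} : f\in\mathbb F_q[x_0,\dots,x_m]\text{ homogeneous of degree }2\text{, or }f=0\}$$ be the second order projective Reed–Muller code, a linear code of length $n=(q^{m+1}-1)/(q-1)$ over $\mathbb F_q$. Let $A_i$ be the number of its codewords of Hamming weight $i$, and let $a_0,a_1,\dots,a_s$ be its nonzero weight distribution, that is, the subsequence of the nonzero terms of $A_0,A_1,\dots,A_n$ in order of appearance. Then $PRM_q(2,m)$ is log-concave, i.e. $a_i^2\ge a_{i-1}a_{i+1}$ for all $1\le i\le s-1$. (This holds for every choice of the representatives $r(P)$.) -/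

import Mathlib

open scoped LinearAlgebra.Projectivization

/-- A finite sequence `a₀, …, aₙ` of real numbers is log-concave if
`aᵢ ^ 2 ≥ aᵢ₋₁ * aᵢ₊₁` for all `1 ≤ i ≤ n - 1`. -/
def IsLogConcaveSeq (a : List ℝ) : Prop :=
  ∀ (i : ℕ) (h : i + 2 < a.length), a[i] * a[i + 2] ≤ a[i + 1] ^ 2

namespace LinearCode

/-- The number `A_i` of codewords of Hamming weight `i` of a linear code `C`, i.e. of a linear
subspace of `F ^ ι`. -/
noncomputable def weightCount {F ι : Type*} [Field F] [DecidableEq F] [Fintype ι]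
    (C : Submodule F (ι → F)) (i : ℕ) : ℕ :=
  Nat.card {c : ι → F // c ∈ C ∧ hammingNorm c = i}

/-- The weight distribution `A_0, A_1, …, A_n`, where `n` is the length of the code. -/
noncomputable def weightDistribution {F ι : Type*} [Field F] [DecidableEq F] [Fintype ι]
    (C : Submodule F (ι → F)) : List ℕ :=
  (List.range (Fintype.card ι + 1)).map (weightCount C)

/-- The nonzero weight distribution: the subsequence of the nonzero terms of the weight
distribution, in order of appearance. -/
noncomputable def nonzeroWeightDistribution {F ι : Type*} [Field F] [DecidableEq F] [Fintype ι]
    (C : Submodule F (ι → F)) : List ℕ :=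
  (weightDistribution C).filter (fun a => a ≠ 0)

/-- A linear code is log-concave if its nonzero weight distribution is log-concave. -/
def IsLogConcave {F ι : Type*} [Field F] [DecidableEq F] [Fintype ι]
    (C : Submodule F (ι → F)) : Prop :=
  IsLogConcaveSeq ((nonzeroWeightDistribution C).map (fun a : ℕ => (a : ℝ)))

/-- The projective Reed-Muller code of order `ν` in dimension `m` over `F`: the space of the vectors
`(f (r P))_P`, where `P` runs over the points of the projective space `PG(m, F)`, the vector `r P`
of homogeneous coordinates of `P` is fixed, and `f` runs over the homogeneous polynomials of
degree `ν` in `m + 1` variables (including `0`). -/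
noncomputable def projectiveReedMuller {F : Type*} [Field F] (ν m : ℕ)
    (r : ℙ F (Fin (m + 1) → F) → (Fin (m + 1) → F)) :
    Submodule F (ℙ F (Fin (m + 1) → F) → F) :=
  (MvPolynomial.homogeneousSubmodule (Fin (m + 1)) F ν).map
    (LinearMap.pi fun P => (MvPolynomial.aeval (r P)).toLinearMap)

end LinearCode

/-! Codewords correspond bijectively to quadratic forms `Q` on `F ^ (m + 1)`, and the weight of the
codeword of `Q` is `q ^ m - excess Q`, so the weight distribution is the distribution of the excess.

That distribution is found without classifying quadratic forms, hence uniformly in the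
characteristic. Count pairs of a form `Q` and a nonzero vector `v` with `Q v = 0`. In coordinates
with `v = (1, 0)` the form is `a * l w + Q' w`. If `l = 0`, then `v` is in the radical and the
excess is `q` times that of `Q'`; if `l ≠ 0`, a hyperbolic plane splits off and the excess is `q`
times that of a form in two variables fewer (`sum_numZeros_sub_one_mul`). The explicit counts
`evenCount` and `oddCount` satisfy the same recursion (`formSum_recursion`). The recursion carries
the weight `numZeros Q - 1`, which can be divided out from three variables on, by Chevalley–Warning;
in two variables the anisotropic forms are recovered from the total number of forms. This gives
`sum_excess`.

In `2 M + 1` variables the forms of rank `2 h` and type `ε` have excess `ε * q ^ (2 M - h)`, and all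
forms of odd rank have excess `0`. Listed by weight, the counts are the hyperbolic ones by
increasing rank, the odd total, and the elliptic ones by decreasing rank. Within one type,
log-concavity is the decrease of successive quotients (`evenCount_logConcave`). Around the middle
the odd total is compared with its largest term (`evenCount_mul_oddTotal_le_sq`,
`evenCount_mul_evenCount_le_sq`). -/

namespace QuadraticForm

variable {F V W U : Type*} [Field F] [AddCommGroup V] [Module F V] [AddCommGroup W] [Module F W]
  [AddCommGroup U] [Module F U]

/-! ### Quadratic forms, their excess, and linear changes of coordinates. -/

instance finite_quadraticForm [Finite F] [Finite V] : Finite (QuadraticForm F V) :=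
  DFunLike.finite _

noncomputable instance fintypeQuadraticForm [Finite F] [Finite V] :
    Fintype (QuadraticForm F V) :=
  Fintype.ofFinite _

/-- The number of zeros of a quadratic form, the zero vector included. -/
noncomputable def numZeros (Q : QuadraticForm F V) : ℕ :=
  Nat.card {v : V // Q v = 0}

/-- The normalized difference between the number of zeros of a quadratic form and the average
number `|V| / |F|` of zeros. -/
noncomputable def excess (Q : QuadraticForm F V) : ℝ :=
  ((numZeros Q : ℝ) - (Nat.card V : ℝ) / Nat.card F) / ((Nat.card F : ℝ) - 1)

theorem numZeros_comp_equiv (Q : QuadraticForm F V) (e : W ≃ₗ[F] V) :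
    numZeros (Q.comp e.toLinearMap) = numZeros Q :=
  Nat.card_congr (e.toEquiv.subtypeEquiv fun _ => Iff.rfl)

theorem excess_comp_equiv (Q : QuadraticForm F V) (e : W ≃ₗ[F] V) :
    excess (Q.comp e.toLinearMap) = excess Q := by
  rw [excess, excess, numZeros_comp_equiv, Nat.card_congr e.toEquiv]

/-- Precomposition with a linear equivalence, as a bijection between quadratic forms. -/
def compEquiv (e : W ≃ₗ[F] V) : QuadraticForm F V ≃ QuadraticForm F W where
  toFun Q := Q.comp e.toLinearMap
  invFun Q := Q.comp e.symm.toLinearMap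
  left_inv Q := by ext; simp
  right_inv Q := by ext; simp

@[simp]
theorem compEquiv_apply (e : W ≃ₗ[F] V) (Q : QuadraticForm F V) (w : W) :
    compEquiv e Q w = Q (e w) := rfl

theorem excess_compEquiv (e : W ≃ₗ[F] V) (Q : QuadraticForm F V) :
    excess (compEquiv e Q) = excess Q :=
  excess_comp_equiv Q e

theorem sum_excess_congr [Finite F] [Finite V] [Finite W] (e : W ≃ₗ[F] V) (φ : ℝ → ℝ) :
    ∑ Q : QuadraticForm F V, φ (excess Q) = ∑ Q : QuadraticForm F W, φ (excess Q) :=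
  Fintype.sum_equiv (compEquiv e) _ _ fun Q => by rw [excess_compEquiv]

/-! ### Adding one coordinate to a quadratic form. -/

/-- The quadratic form `c a² + a ℓ(w) + Q w` on `F × W`. -/
def extend (c : F) (l : Module.Dual F W) (Q : QuadraticForm F W) : QuadraticForm F (F × W) :=
  c • QuadraticMap.linMulLin (LinearMap.fst F F W) (LinearMap.fst F F W) +
    QuadraticMap.linMulLin (LinearMap.fst F F W) (l ∘ₗ LinearMap.snd F F W) +
    Q.comp (LinearMap.snd F F W)

@[simp]
theorem extend_apply (c : F) (l : Module.Dual F W) (Q : QuadraticForm F W) (x : F × W) :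
    extend c l Q x = c * (x.1 * x.1) + x.1 * l x.2 + Q x.2 := by
  simp [extend]

/-- Every quadratic form on `F × W` is uniquely of the form `extend c l Q`. -/
def extendEquiv : F × Module.Dual F W × QuadraticForm F W ≃ QuadraticForm F (F × W) where
  toFun p := extend p.1 p.2.1 p.2.2
  invFun Q := (Q (1, 0), Q.polarBilin (1, 0) ∘ₗ LinearMap.inr F F W, Q.comp (LinearMap.inr F F W))
  left_inv p := by
    obtain ⟨c, l, Q⟩ := p
    refine Prod.ext (by simp) (Prod.ext ?_ ?_)
    · ext w
      simp [QuadraticMap.polar]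
      ring
    · ext w
      simp
  right_inv Q := by
    ext ⟨a, w⟩
    have h : ((a, w) : F × W) = a • ((1, 0) : F × W) + (0, w) := by simp
    have h2 : Q (a • ((1, 0) : F × W) + (0, w)) =
        Q (a • ((1, 0) : F × W)) + Q (0, w) +
          QuadraticMap.polar Q (a • ((1, 0) : F × W)) (0, w) := by
      rw [QuadraticMap.polar]; ring
    rw [h, h2, QuadraticMap.map_smul, QuadraticMap.polar_smul_left]
    simp
    ring

@[simp]
theorem extendEquiv_apply (p : F × Module.Dual F W × QuadraticForm F W) :
    extendEquiv p = extend p.1 p.2.1 p.2.2 := rfl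

/-- Since `l w = 1`, the space is the direct sum of the line of `w` and `ker l`, and `ker l` has the
dimension of `U`. This serves both to move an isotropic vector to `(1, 0)` and to turn a nonzero
functional into the first coordinate. -/
theorem exists_linearEquiv_of_dual_apply_eq_one [Finite F] [Finite U]
    (l : Module.Dual F (F × U)) (w : F × U) (h : l w = 1) :
    ∃ e : (F × U) ≃ₗ[F] (F × U), e (1, 0) = w ∧ ∀ x, l (e x) = x.1 := by
  have hl : l ≠ 0 := by rintro rfl; simp at h
  have hr : Module.finrank F U = Module.finrank F (LinearMap.ker l) := by
    have h1 := l.finrank_range_add_finrank_ker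
    have h2 : Module.finrank F (LinearMap.range l) = 1 := by
      rw [LinearMap.range_eq_top.2 (LinearMap.surjective hl), finrank_top, Module.finrank_self]
    rw [Module.finrank_prod, Module.finrank_self] at h1
    omega
  let k := LinearEquiv.ofFinrankEq U (LinearMap.ker l) hr
  let g : (F × U) →ₗ[F] (F × U) :=
    (LinearMap.toSpanSingleton F _ w).coprod ((LinearMap.ker l).subtype ∘ₗ k.toLinearMap)
  have hg : ∀ x, g x = x.1 • w + (k x.2 : F × U) := fun x => by simp [g]
  have hlg : ∀ x, l (g x) = x.1 := fun x => by
    have hk : l (k x.2 : F × U) = 0 := (k x.2).2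
    rw [hg, map_add, map_smul, h, hk]; simp
  have hinj : Function.Injective g := by
    rw [← LinearMap.ker_eq_bot, LinearMap.ker_eq_bot']
    intro x hx
    have h1 : x.1 = 0 := by rw [← hlg, hx, map_zero]
    have h2 : k x.2 = 0 := by
      have := hg x
      rw [hx, h1] at this
      simpa using this.symm
    exact Prod.ext h1 (by simpa using h2)
  refine ⟨LinearEquiv.ofInjectiveEndo g hinj, ?_, fun x => ?_⟩
  · simp [hg]
  · simpa using hlg x

theorem card_real_ne_zero [Finite F] : (Nat.card F : ℝ) ≠ 0 := by
  have := Nat.card_pos (α := F)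
  positivity

theorem two_le_card_real [Finite F] : (2 : ℝ) ≤ Nat.card F := by
  have : 1 < Nat.card F := Finite.one_lt_card
  exact_mod_cast this

theorem excess_eq_of_numZeros {Q : QuadraticForm F V} {Q' : QuadraticForm F W}
    (h : (numZeros Q : ℝ) - (Nat.card V : ℝ) / Nat.card F =
      Nat.card F * ((numZeros Q' : ℝ) - (Nat.card W : ℝ) / Nat.card F)) :
    excess Q = Nat.card F * excess Q' := by
  rw [excess, excess, h, mul_div_assoc]

theorem excess_extend_zero [Finite F] (Q : QuadraticForm F W) :
    excess (extend 0 0 Q) = Nat.card F * excess Q := by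
  have h : numZeros (extend 0 0 Q) = Nat.card F * numZeros Q := by
    rw [numZeros, numZeros, ← Nat.card_prod]
    exact Nat.card_congr
      { toFun := fun x => (x.1.1, ⟨x.1.2, by simpa using x.2⟩)
        invFun := fun x => ⟨(x.1, x.2.1), by simpa using x.2.2⟩
        left_inv := fun _ => rfl
        right_inv := fun _ => rfl }
  apply excess_eq_of_numZeros
  rw [h, Nat.card_prod]
  have := card_real_ne_zero (F := F)
  push_cast
  field_simp

/-- The form is `b * (a + c * b + l u) + Q u`. For `b ≠ 0` every `u` admits exactly one `a`; for `b
= 0` the coordinate `a` is free and `Q u = 0`. Thus `c` and `l` have no influence: a hyperbolic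
plane has been split off. -/
theorem excess_extend_fst [Finite F] [Finite U] (c : F) (l : Module.Dual F U)
    (Q : QuadraticForm F U) :
    excess (extend 0 (LinearMap.fst F F U) (extend c l Q)) = Nat.card F * excess Q := by
  classical
  have h : numZeros (extend 0 (LinearMap.fst F F U) (extend c l Q)) =
      (Nat.card F - 1) * Nat.card U + Nat.card F * numZeros Q := by
    have hu : Nat.card F - 1 = Nat.card Fˣ := by
      have := Fintype.ofFinite F
      rw [Nat.card_eq_fintype_card, Nat.card_eq_fintype_card, Fintype.card_units]
    rw [numZeros, numZeros, ← Nat.card_prod, hu, ← Nat.card_prod, ← Nat.card_sum]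
    refine Nat.card_congr
      { toFun := fun x => if hb : x.1.2.1 = 0 then Sum.inr (x.1.1, ⟨x.1.2.2, ?_⟩)
          else Sum.inl (Units.mk0 x.1.2.1 hb, x.1.2.2)
        invFun := Sum.elim
          (fun y => ⟨(-(extend c l Q (y.1, y.2)) / y.1, (y.1, y.2)), ?_⟩)
          (fun y => ⟨(y.1, (0, y.2.1)), ?_⟩)
        left_inv := ?_
        right_inv := ?_ }
    · have := x.2
      simpa [hb] using this
    · have := y.1.ne_zero
      simp only [extend_apply, LinearMap.fst_apply]
      field_simp
      ring
    · simpa using y.2.2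
    · rintro ⟨⟨a, b, u⟩, hx⟩
      by_cases hb : b = 0
      · subst hb
        simp
      · simp only [hb, dite_false, Sum.elim_inl, Units.val_mk0, Subtype.mk.injEq, Prod.mk.injEq,
          and_true]
        simp only [extend_apply, LinearMap.fst_apply] at hx
        rw [extend_apply]
        field_simp
        linear_combination -hx
    · rintro (⟨b, u⟩ | ⟨a, u⟩)
      · have := b.ne_zero
        simp [this]
      · simp
  apply excess_eq_of_numZeros
  have h1 : 1 ≤ Nat.card F := Nat.card_pos
  rw [h, Nat.card_prod, Nat.card_prod]
  have := card_real_ne_zero (F := F)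
  push_cast [Nat.cast_sub h1]
  field_simp
  ring

theorem card_dual [Finite U] : Nat.card (Module.Dual F U) = Nat.card U := by
  have h : Module.finrank F (Module.Dual F U) = Module.finrank F U := Subspace.dual_finrank_eq
  exact Nat.card_congr (LinearEquiv.ofFinrankEq _ _ h).toEquiv

theorem card_quadraticForm_prod [Finite W] : Nat.card (QuadraticForm F (F × W)) =
    Nat.card F * Nat.card W * Nat.card (QuadraticForm F W) := by
  rw [← Nat.card_congr extendEquiv, Nat.card_prod, Nat.card_prod, card_dual, mul_assoc]

/-! ### Double counting of forms and isotropic vectors. -/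

theorem sum_excess_extend_fst [Finite F] [Finite U] (φ : ℝ → ℝ) :
    ∑ Q : QuadraticForm F (F × U), φ (excess (extend 0 (LinearMap.fst F F U) Q)) =
      (Nat.card F * Nat.card U : ℝ) * ∑ Q : QuadraticForm F U, φ (Nat.card F * excess Q) := by
  have := Fintype.ofFinite F
  have : Finite (Module.Dual F U) := DFunLike.finite _
  have := Fintype.ofFinite (Module.Dual F U)
  rw [← Fintype.sum_equiv extendEquiv
    (fun p => φ (Nat.card F * excess p.2.2)) _ (fun p => by
      rw [extendEquiv_apply, excess_extend_fst])]
  rw [Fintype.sum_prod_type]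
  simp only [Fintype.sum_prod_type, Finset.sum_const, Finset.card_univ, nsmul_eq_mul]
  rw [← Nat.card_eq_fintype_card, ← Nat.card_eq_fintype_card, card_dual, mul_assoc]

theorem sum_excess_extend_of_ne_zero [Finite F] [Finite U] (φ : ℝ → ℝ)
    {l : Module.Dual F (F × U)} (hl : l ≠ 0) :
    ∑ Q : QuadraticForm F (F × U), φ (excess (extend 0 l Q)) =
      ∑ Q : QuadraticForm F (F × U), φ (excess (extend 0 (LinearMap.fst F F U) Q)) := by
  obtain ⟨w, hw⟩ := LinearMap.surjective hl 1
  obtain ⟨e, -, he⟩ := exists_linearEquiv_of_dual_apply_eq_one l w hw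
  refine Fintype.sum_equiv (compEquiv e) _ _ fun Q => ?_
  rw [← excess_compEquiv ((LinearEquiv.refl F F).prodCongr e)]
  congr 2
  ext x
  simp [he]

/-- In coordinates where `v` is `(1, 0)`, vanishing at `v` means that the coefficient `c` of `extend
c l Q` is zero. The right-hand side does not depend on `v`. -/
theorem sum_excess_of_isotropic [Finite F] [Finite W] (φ : ℝ → ℝ) {v : F × W} (hv : v ≠ 0)
    [DecidablePred fun Q : QuadraticForm F (F × W) => Q v = 0]
    [Fintype (Module.Dual F W)] :
    ∑ Q : QuadraticForm F (F × W) with Q v = 0, φ (excess Q) =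
      ∑ l : Module.Dual F W, ∑ Q : QuadraticForm F W, φ (excess (extend 0 l Q)) := by
  obtain ⟨l, hl⟩ : ∃ l : Module.Dual F (F × W), l v = 1 := by
    obtain ⟨f, hf⟩ := Module.Projective.exists_dual_ne_zero F hv
    exact ⟨(f v)⁻¹ • f, by simp [hf]⟩
  obtain ⟨e, he, -⟩ := exists_linearEquiv_of_dual_apply_eq_one l v hl
  rw [← Fintype.sum_prod_type']
  symm
  refine Finset.sum_bij (fun p _ => (compEquiv e).symm (extend 0 p.1 p.2)) ?_ ?_ ?_ ?_
  · intro p _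
    simp only [Finset.mem_filter, Finset.mem_univ, true_and]
    rw [← he]
    change extend 0 p.1 p.2 (e.symm (e (1, 0))) = 0
    simp
  · intro p _ p' _ h
    have h1 := extendEquiv.injective (a₁ := ((0 : F), p)) (a₂ := ((0 : F), p'))
      ((compEquiv e).symm.injective h)
    simpa using h1
  · intro Q hQ
    simp only [Finset.mem_filter, Finset.mem_univ, true_and] at hQ
    obtain ⟨⟨c, p⟩, hp⟩ := extendEquiv.surjective (compEquiv e Q)
    have hc : c = 0 := by
      have := DFunLike.congr_fun hp ((1, 0) : F × W)
      simpa [he, hQ] using this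
    refine ⟨p, Finset.mem_univ _, ?_⟩
    rw [Equiv.symm_apply_eq, ← hp, hc]
    rfl
  · intro p _
    rw [← excess_compEquiv e ((compEquiv e).symm _), Equiv.apply_symm_apply]

/-- Double counting of the pairs of a quadratic form and a nonzero isotropic vector. -/
theorem sum_numZeros_sub_one_mul [Finite F] [Finite U] (φ : ℝ → ℝ) :
    ∑ Q : QuadraticForm F (F × (F × U)), ((numZeros Q : ℝ) - 1) * φ (excess Q) =
      ((Nat.card F : ℝ) * (Nat.card F * Nat.card U) - 1) *
        (∑ Q : QuadraticForm F (F × U), φ (Nat.card F * excess Q) +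
          (Nat.card F * Nat.card U - 1 : ℝ) * ((Nat.card F * Nat.card U : ℝ) *
            ∑ Q : QuadraticForm F U, φ (Nat.card F * excess Q))) := by
  classical
  have := Fintype.ofFinite F
  have := Fintype.ofFinite U
  have : Finite (Module.Dual F (F × U)) := DFunLike.finite _
  have := Fintype.ofFinite (Module.Dual F (F × U))
  have h1 : ∀ Q : QuadraticForm F (F × (F × U)), ((numZeros Q : ℝ) - 1) * φ (excess Q) =
      ∑ v : F × (F × U) with v ≠ 0, if Q v = 0 then φ (excess Q) else 0 := fun Q => by
    rw [← Finset.sum_filter, Finset.sum_const, nsmul_eq_mul, Finset.filter_filter]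
    congr 1
    have h2 : (Finset.univ.filter fun v : F × (F × U) => v ≠ 0 ∧ Q v = 0) =
        (Finset.univ.filter fun v => Q v = 0).erase 0 := by
      ext v
      simp
    rw [h2, Finset.card_erase_of_mem (by simp), numZeros, Nat.card_eq_fintype_card,
      Fintype.card_subtype, Nat.cast_sub (Finset.card_pos.2 ⟨0, by simp⟩)]
    simp
  rw [Finset.sum_congr rfl fun Q _ => h1 Q, Finset.sum_comm]
  have h2 : ∀ v ∈ Finset.univ.filter (fun v : F × (F × U) => v ≠ 0),
      (∑ Q : QuadraticForm F (F × (F × U)), if Q v = 0 then φ (excess Q) else 0) =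
      ∑ Q : QuadraticForm F (F × U), φ (Nat.card F * excess Q) +
          (Nat.card F * Nat.card U - 1 : ℝ) * ((Nat.card F * Nat.card U : ℝ) *
            ∑ Q : QuadraticForm F U, φ (Nat.card F * excess Q)) := by
    intro v hv
    -- The functional `l = 0` (the vector lies in the radical) is split off; all the other
    -- functionals contribute equally.
    rw [← Finset.sum_filter, sum_excess_of_isotropic φ (by simpa using hv),
      ← Finset.add_sum_erase _ _ (Finset.mem_univ 0)]
    congr 1
    · simp only [excess_extend_zero]
    · rw [Finset.sum_congr rfl fun l hl => (sum_excess_extend_of_ne_zero φ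
        (Finset.ne_of_mem_erase hl)).trans (sum_excess_extend_fst φ), Finset.sum_const,
        nsmul_eq_mul, Finset.card_erase_of_mem (Finset.mem_univ _), Finset.card_univ,
        Nat.cast_sub Fintype.card_pos, ← Nat.card_eq_fintype_card, card_dual, Nat.card_prod]
      simp
  rw [Finset.sum_congr rfl h2, Finset.sum_const, nsmul_eq_mul]
  congr 1
  rw [Finset.filter_ne' , Finset.card_erase_of_mem (Finset.mem_univ _), Finset.card_univ,
    Nat.cast_sub Fintype.card_pos, ← Nat.card_eq_fintype_card, Nat.card_prod, Nat.card_prod]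
  simp

end QuadraticForm

/-! ### The explicit counting formulas and their recursion. -/

namespace QuadraticCount

/-- The product `∏_{i < k} (x / q ^ i - 1)`. -/
noncomputable def descProd (q x : ℝ) (k : ℕ) : ℝ :=
  ∏ i ∈ Finset.range k, (x / q ^ i - 1)

/-- The product `∏_{i < h} (q ^ (2 i + 2) - 1)`. -/
noncomputable def evenProd (q : ℝ) (h : ℕ) : ℝ :=
  ∏ i ∈ Finset.range h, (q ^ (2 * i + 2) - 1)

/-- The number of quadratic forms of rank `2 h` and type `ε` (`1` for hyperbolic, `-1` for
elliptic) on a space with `x` elements over the field with `q` elements. -/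
noncomputable def evenCount (q ε x : ℝ) (h : ℕ) : ℝ :=
  (q ^ h + ε) / 2 * q ^ (h ^ 2) * descProd q x (2 * h) / evenProd q h

/-- The number of quadratic forms of rank `2 h + 1` on a space with `x` elements over the field
with `q` elements. -/
noncomputable def oddCount (q x : ℝ) (h : ℕ) : ℝ :=
  q ^ (h * (h + 1)) * descProd q x (2 * h + 1) / evenProd q h

theorem descProd_succ (q x : ℝ) (k : ℕ) :
    descProd q x (k + 1) = descProd q x k * (x / q ^ k - 1) :=
  Finset.prod_range_succ _ _

theorem descProd_succ' (q x : ℝ) (k : ℕ) :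
    descProd q x (k + 1) = (x - 1) * descProd q (x / q) k := by
  rw [descProd, Finset.prod_range_succ', mul_comm]
  simp [descProd, pow_succ', div_div]

theorem evenProd_succ (q : ℝ) (h : ℕ) :
    evenProd q (h + 1) = evenProd q h * (q ^ (2 * h + 2) - 1) :=
  Finset.prod_range_succ _ _

variable {q : ℝ}

theorem evenFactor_pos (hq : 2 ≤ q) (h : ℕ) : 0 < q ^ (2 * h + 2) - 1 :=
  sub_pos.2 (one_lt_pow₀ (by linarith) (by omega))

theorem evenProd_pos (hq : 2 ≤ q) (h : ℕ) : 0 < evenProd q h :=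
  Finset.prod_pos fun i _ => evenFactor_pos hq i

/-- The factor of index `N` vanishes. Counts of ranks above the dimension are therefore zero, and
the sums over ranks may be cut at any sufficiently large bound. -/
theorem descProd_pow_eq_zero (hq : 2 ≤ q) {N k : ℕ} (h : N < k) :
    descProd q (q ^ N) k = 0 := by
  refine Finset.prod_eq_zero (Finset.mem_range.2 h) ?_
  have : q ^ N ≠ 0 := by positivity
  rw [div_self this, sub_self]

theorem descProd_pow_pos (hq : 2 ≤ q) {N k : ℕ} (h : k ≤ N) :
    0 < descProd q (q ^ N) k := by
  refine Finset.prod_pos fun i hi => ?_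
  have hi := Finset.mem_range.1 hi
  have h0 : (0 : ℝ) < q ^ i := by positivity
  rw [sub_pos, one_lt_div h0]
  exact pow_lt_pow_right₀ (by linarith) (by omega)

theorem evenCount_zero_one (x : ℝ) : evenCount q 1 x 0 = 1 := by
  simp [evenCount, descProd, evenProd]

theorem evenCount_zero_neg_one (x : ℝ) : evenCount q (-1) x 0 = 0 := by
  simp [evenCount]

theorem evenCount_pow_eq_zero (hq : 2 ≤ q) (ε : ℝ) {N h : ℕ} (hN : N < 2 * h) :
    evenCount q ε (q ^ N) h = 0 := by
  rw [evenCount, descProd_pow_eq_zero hq hN]; simp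

theorem oddCount_pow_eq_zero (hq : 2 ≤ q) {N h : ℕ} (hN : N < 2 * h + 1) :
    oddCount q (q ^ N) h = 0 := by
  rw [oddCount, descProd_pow_eq_zero hq hN]; simp

/-- The quotient of consecutive counts, multiplied out because `q ^ h + ε` vanishes for `h = 0` and
`ε = -1`. -/
theorem evenCount_succ_mul (hq : 2 ≤ q) (ε x : ℝ) (h : ℕ) :
    evenCount q ε x (h + 1) * ((q ^ h + ε) * (q ^ (2 * h + 2) - 1)) =
      evenCount q ε x h * ((q ^ (h + 1) + ε) * q ^ (2 * h + 1) *
        ((x / q ^ (2 * h) - 1) * (x / q ^ (2 * h + 1) - 1))) := by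
  have h1 := evenProd_pos hq h
  have h2 := evenFactor_pos hq h
  rw [evenCount, evenCount, show 2 * (h + 1) = 2 * h + 1 + 1 by ring, descProd_succ, descProd_succ,
    evenProd_succ, show (h + 1) ^ 2 = h ^ 2 + (2 * h + 1) by ring, pow_add q (h ^ 2)]
  field_simp

theorem oddCount_succ_mul (hq : 2 ≤ q) (x : ℝ) (h : ℕ) :
    oddCount q x (h + 1) * (q ^ (2 * h + 2) - 1) =
      oddCount q x h * (q ^ (2 * h + 2) *
        ((x / q ^ (2 * h + 1) - 1) * (x / q ^ (2 * h + 2) - 1))) := by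
  have h1 := evenProd_pos hq h
  have h2 := evenFactor_pos hq h
  rw [oddCount, oddCount, show 2 * (h + 1) + 1 = 2 * h + 1 + 1 + 1 by ring, descProd_succ,
    descProd_succ q x (2 * h + 1),
    evenProd_succ, show (h + 1) * (h + 1 + 1) = h * (h + 1) + (2 * h + 2) by ring,
    pow_add q (h * (h + 1))]
  field_simp

theorem oddCount_mul (q x : ℝ) (h : ℕ) (ε : ℝ) :
    oddCount q x h * (q ^ h + ε) =
      evenCount q ε x h * (2 * q ^ h * (x / q ^ (2 * h) - 1)) := by
  rw [oddCount, evenCount, descProd_succ, show h * (h + 1) = h ^ 2 + h by ring, pow_add]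
  ring

theorem evenCount_recursion_zero (hq : 2 ≤ q) {ε : ℝ} (hε : ε = 1 ∨ ε = -1) (x : ℝ) :
    evenCount q ε x 0 * (x / q + (q - 1) * (ε * x / q ^ (0 + 1)) - 1) =
      (x - 1) * evenCount q ε (x / q) 0 := by
  rcases hε with rfl | rfl
  · rw [evenCount_zero_one, evenCount_zero_one]
    field_simp
    ring
  · simp [evenCount_zero_neg_one]

/-- The analogue of the double count for one rank and type: removing an isotropic vector keeps the
rank if it lies in the radical and lowers it by two otherwise. -/
theorem evenCount_recursion_succ (hq : 2 ≤ q) {ε : ℝ} (hε : ε = 1 ∨ ε = -1) (x : ℝ) (h : ℕ) :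
    evenCount q ε x (h + 1) * (x / q + (q - 1) * (ε * x / q ^ (h + 1 + 1)) - 1) =
      (x - 1) * (evenCount q ε (x / q) (h + 1) +
        (x / q - 1) * (x / q * evenCount q ε (x / q / q) h)) := by
  have h1 := evenProd_pos hq h
  have h2 := evenFactor_pos hq h
  have h3 : ε ^ 2 = 1 := by rcases hε with rfl | rfl <;> norm_num
  have e1 : descProd q x (2 * (h + 1)) =
      (x - 1) * ((x / q - 1) * descProd q (x / q / q) (2 * h)) := by
    rw [show 2 * (h + 1) = 2 * h + 1 + 1 by ring, descProd_succ', descProd_succ']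
  have e2 : descProd q (x / q) (2 * (h + 1)) =
      (x / q - 1) * (descProd q (x / q / q) (2 * h) * (x / q / q / q ^ (2 * h) - 1)) := by
    rw [show 2 * (h + 1) = 2 * h + 1 + 1 by ring, descProd_succ', descProd_succ]
  rw [evenCount, evenCount, evenCount, e1, e2, evenProd_succ,
    show (h + 1) ^ 2 = h ^ 2 + (2 * h + 1) by ring, pow_add q (h ^ 2)]
  have hq0 : q ≠ 0 := by positivity
  have h2' : (q ^ h) ^ 2 * q ^ 2 - 1 ≠ 0 := by
    have : (q ^ h) ^ 2 * q ^ 2 - 1 = q ^ (2 * h + 2) - 1 := by ring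
    rw [this]; exact h2.ne'
  have ha : q ^ h ≠ 0 := by positivity
  -- With the common factors abstracted, what remains is an identity of rational functions in `q`,
  -- `q ^ h` and `x`, valid modulo `ε ^ 2 = 1`.
  simp only [pow_add, pow_mul', pow_one]
  generalize q ^ h = a at *
  generalize descProd q (x / q / q) (2 * h) = D
  generalize evenProd q h = E at *
  generalize q ^ (h ^ 2) = G
  field_simp
  ring_nf
  rw [h3]
  ring

theorem oddCount_recursion_zero (q x : ℝ) :
    oddCount q x 0 * (x / q - 1) = (x - 1) * oddCount q (x / q) 0 := by
  simp [oddCount, evenProd, descProd]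

theorem oddCount_recursion_succ (hq : 2 ≤ q) (x : ℝ) (h : ℕ) :
    oddCount q x (h + 1) * (x / q - 1) =
      (x - 1) * (oddCount q (x / q) (h + 1) +
        (x / q - 1) * (x / q * oddCount q (x / q / q) h)) := by
  have h1 := evenProd_pos hq h
  have h2 := evenFactor_pos hq h
  have e1 : descProd q x (2 * (h + 1) + 1) =
      (x - 1) * ((x / q - 1) * descProd q (x / q / q) (2 * h + 1)) := by
    rw [show 2 * (h + 1) + 1 = 2 * h + 1 + 1 + 1 by ring, descProd_succ', descProd_succ']
  have e2 : descProd q (x / q) (2 * (h + 1) + 1) =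
      (x / q - 1) * (descProd q (x / q / q) (2 * h + 1) * (x / q / q / q ^ (2 * h + 1) - 1)) := by
    rw [show 2 * (h + 1) + 1 = 2 * h + 1 + 1 + 1 by ring, descProd_succ', descProd_succ]
  rw [oddCount, oddCount, oddCount, e1, e2, evenProd_succ,
    show (h + 1) * (h + 1 + 1) = h * (h + 1) + (2 * h + 2) by ring, pow_add q (h * (h + 1))]
  generalize descProd q (x / q / q) (2 * h + 1) = D
  generalize q ^ (h * (h + 1)) = G
  field_simp
  ring

/-- The contribution of the forms of even rank and type `ε` to a sum over all quadratic forms of a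
function of their excess. -/
noncomputable def evenSum (q ε x : ℝ) (K : ℕ) (φ : ℝ → ℝ) : ℝ :=
  ∑ h ∈ Finset.range K, evenCount q ε x h * φ (ε * x / q ^ (h + 1))

/-- The number of the forms of odd rank. -/
noncomputable def oddTotal (q x : ℝ) (K : ℕ) : ℝ :=
  ∑ h ∈ Finset.range K, oddCount q x h

/-- Rescaling by `q` aligns the excess values on the two sides, so the recursion of the counts can
be summed. Rank zero does not arise from a lower rank, which is why the last sum has one term fewer.
-/
theorem evenSum_recursion (hq : 2 ≤ q) {ε : ℝ} (hε : ε = 1 ∨ ε = -1) (x : ℝ) (K : ℕ)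
    (φ : ℝ → ℝ) :
    evenSum q ε x (K + 1) (fun e => (x / q + (q - 1) * e - 1) * φ e) =
      (x - 1) * (evenSum q ε (x / q) (K + 1) (fun e => φ (q * e)) +
        (x / q - 1) * (x / q * evenSum q ε (x / q / q) K (fun e => φ (q * e)))) := by
  have hq0 : q ≠ 0 := by positivity
  have e1 : ∀ h : ℕ, q * (ε * (x / q) / q ^ (h + 1)) = ε * x / q ^ (h + 1) := fun h => by
    field_simp
  have e2 : ∀ h : ℕ, q * (ε * (x / q / q) / q ^ (h + 1)) = ε * x / q ^ (h + 1 + 1) := fun h => by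
    field_simp
    ring
  simp only [evenSum]
  rw [Finset.sum_range_succ', Finset.sum_range_succ']
  simp only [e1, e2]
  have h0 := evenCount_recursion_zero hq hε x
  have h1 : ∀ h ∈ Finset.range K, evenCount q ε x (h + 1) *
      ((x / q + (q - 1) * (ε * x / q ^ (h + 1 + 1)) - 1) * φ (ε * x / q ^ (h + 1 + 1))) =
      (x - 1) * (evenCount q ε (x / q) (h + 1) * φ (ε * x / q ^ (h + 1 + 1)) +
        (x / q - 1) * (x / q * (evenCount q ε (x / q / q) h * φ (ε * x / q ^ (h + 1 + 1))))) :=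
    fun h _ => by
      rw [← mul_assoc, evenCount_recursion_succ hq hε]; ring
  rw [Finset.sum_congr rfl h1, ← Finset.mul_sum, Finset.sum_add_distrib, ← Finset.mul_sum,
    ← Finset.mul_sum, ← mul_assoc (evenCount q ε x 0), h0]
  ring

theorem oddTotal_recursion (hq : 2 ≤ q) (x : ℝ) (K : ℕ) :
    oddTotal q x (K + 1) * (x / q - 1) =
      (x - 1) * (oddTotal q (x / q) (K + 1) +
        (x / q - 1) * (x / q * oddTotal q (x / q / q) K)) := by
  simp only [oddTotal]
  rw [Finset.sum_range_succ', Finset.sum_range_succ', add_mul, Finset.sum_mul,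
    oddCount_recursion_zero, Finset.sum_congr rfl fun h _ => oddCount_recursion_succ hq x h,
    ← Finset.mul_sum, Finset.sum_add_distrib, ← Finset.mul_sum, ← Finset.mul_sum]
  ring

/-- The sum over all quadratic forms of a function of their excess. -/
noncomputable def formSum (q x : ℝ) (K : ℕ) (φ : ℝ → ℝ) : ℝ :=
  evenSum q 1 x K φ + evenSum q (-1) x K φ + oddTotal q x K * φ 0

theorem formSum_recursion (hq : 2 ≤ q) (x : ℝ) (K : ℕ) (φ : ℝ → ℝ) :
    formSum q x (K + 1) (fun e => (x / q + (q - 1) * e - 1) * φ e) =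
      (x - 1) * (formSum q (x / q) (K + 1) (fun e => φ (q * e)) +
        (x / q - 1) * (x / q * formSum q (x / q / q) K (fun e => φ (q * e)))) := by
  have h := oddTotal_recursion hq x K
  simp only [formSum, evenSum_recursion hq (Or.inl rfl), evenSum_recursion hq (Or.inr rfl),
    mul_zero, add_zero]
  rw [← mul_assoc (oddTotal q x (K + 1)), h]
  ring

theorem evenSum_pow_eq (hq : 2 ≤ q) (ε : ℝ) {N K L : ℕ} (hL : N < 2 * L) (hK : L ≤ K)
    (φ : ℝ → ℝ) : evenSum q ε (q ^ N) K φ = evenSum q ε (q ^ N) L φ := by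
  refine (Finset.sum_subset (Finset.range_subset_range.2 hK) fun h _ hh => ?_).symm
  have hh : L ≤ h := by simpa using hh
  rw [evenCount_pow_eq_zero hq _ (by omega), zero_mul]

theorem oddTotal_pow_eq (hq : 2 ≤ q) {N K L : ℕ} (hL : N < 2 * L + 1) (hK : L ≤ K) :
    oddTotal q (q ^ N) K = oddTotal q (q ^ N) L := by
  refine (Finset.sum_subset (Finset.range_subset_range.2 hK) fun h _ hh => ?_).symm
  have hh : L ≤ h := by simpa using hh
  rw [oddCount_pow_eq_zero hq (by omega)]

theorem formSum_pow_eq (hq : 2 ≤ q) {N K L : ℕ} (hL : N < 2 * L) (hK : L ≤ K)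
    (φ : ℝ → ℝ) : formSum q (q ^ N) K φ = formSum q (q ^ N) L φ := by
  rw [formSum, formSum, evenSum_pow_eq hq _ hL hK, evenSum_pow_eq hq _ hL hK,
    oddTotal_pow_eq hq (by omega) hK]

theorem formSum_zero (φ : ℝ → ℝ) : formSum q 1 1 φ = φ (1 / q) := by
  simp [formSum, evenSum, oddTotal, evenCount_zero_one, evenCount_zero_neg_one, oddCount, descProd]

theorem formSum_one (hq : 2 ≤ q) (φ : ℝ → ℝ) : formSum q q 1 φ = φ 1 + (q - 1) * φ 0 := by
  have hq0 : q ≠ 0 := by positivity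
  simp [formSum, evenSum, oddTotal, evenCount_zero_one, evenCount_zero_neg_one, oddCount, descProd,
    evenProd, hq0]

theorem formSum_two (hq : 2 ≤ q) (φ : ℝ → ℝ) : formSum q (q ^ 2) 2 φ =
    φ q + (q + 1) / 2 * q * (q - 1) * φ 1 + (q - 1) / 2 * q * (q - 1) * φ (-1) +
      (q ^ 2 - 1) * φ 0 := by
  have hq0 : q ≠ 0 := by positivity
  have h2 : q ^ 2 - 1 ≠ 0 := (evenFactor_pos hq 0).ne'
  have h4 : oddCount q (q ^ 2) 1 = 0 := oddCount_pow_eq_zero hq (by norm_num)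
  have h5 : q ^ 2 / q = q := by field_simp
  have h6 : oddCount q (q ^ 2) 0 = q ^ 2 - 1 := by simp [oddCount, descProd, evenProd]
  have h7 : ∀ ε, evenCount q ε (q ^ 2) 1 = (q + ε) / 2 * q * (q - 1) := fun ε => by
    simp only [evenCount, descProd, evenProd, Finset.prod_range_succ, Finset.prod_range_zero,
      mul_one, mul_zero, zero_add, one_mul, pow_zero, div_one, pow_one, one_pow]
    field_simp
  have h8 : ∀ ε : ℝ, ε * q ^ 2 / q ^ 2 = ε := fun ε => by
    field_simp
  have h9 : (1 : ℝ) * q ^ 2 / q = q := by rw [one_mul, h5]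
  simp only [formSum, evenSum, oddTotal, Finset.sum_range_succ, Finset.sum_range_zero,
    evenCount_zero_one, evenCount_zero_neg_one, h4, h6, h7, h8, h9, Nat.reduceAdd, zero_add,
    pow_one,
    zero_mul]
  ring

/-- In at least three variables `formSum` ignores the values of `φ` at the excess of a form whose
only zero is the zero vector. -/
theorem formSum_congr (hq : 2 ≤ q) (n K : ℕ) {φ ψ : ℝ → ℝ}
    (h : ∀ e, q ^ (n + 3) / q + (q - 1) * e - 1 ≠ 0 → φ e = ψ e) :
    formSum q (q ^ (n + 3)) K φ = formSum q (q ^ (n + 3)) K ψ := by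
  have hq1 : 1 < q := by linarith
  have hx : q ^ (n + 3) / q = q ^ (n + 2) := by
    field_simp
    ring
  have hx1 : 1 < q ^ (n + 2) := one_lt_pow₀ hq1 (by omega)
  simp only [formSum, evenSum]
  congr 1
  · congr 1
    · refine Finset.sum_congr rfl fun i _ => ?_
      rw [h]
      rw [hx]
      have : 0 < (q - 1) * (1 * q ^ (n + 3) / q ^ (i + 1)) :=
        mul_pos (by linarith) (by positivity)
      linarith
    · refine Finset.sum_congr rfl fun i _ => ?_
      rcases i with _ | i
      · simp [evenCount_zero_neg_one]
      · rw [h]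
        have h1 : q ^ (n + 3) / q ^ (i + 1 + 1) ≤ q ^ (n + 1) := by
          rw [div_le_iff₀ (by positivity), ← pow_add]
          exact pow_le_pow_right₀ hq1.le (by omega)
        have h2 : (q - 1) * (q ^ (n + 3) / q ^ (i + 1 + 1)) ≤ (q - 1) * q ^ (n + 1) :=
          mul_le_mul_of_nonneg_left h1 (by linarith)
        have h3 : 1 < q ^ (n + 1) := one_lt_pow₀ hq1 (by omega)
        have h4 : q ^ (n + 2) = q * q ^ (n + 1) := by ring
        rw [hx, neg_one_mul, neg_div, mul_neg, h4]
        linarith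
  · rw [h]
    rw [hx, mul_zero, add_zero]
    linarith
end QuadraticCount

/-! ### The distribution of the excess, by induction on the dimension. -/

namespace QuadraticForm

open QuadraticCount MvPolynomial

variable {F : Type*} [Field F]

/-- Every quadratic form on `F ^ n` is given by a homogeneous polynomial of degree `2`. -/
theorem exists_homogeneous_eval_eq {n : ℕ} (Q : QuadraticForm F (Fin n → F)) :
    ∃ p ∈ homogeneousSubmodule (Fin n) F 2, ∀ x, eval x p = Q x := by
  let B := Q.toBilin (Pi.basisFun F (Fin n))
  refine ⟨∑ i, ∑ j, C (B (Pi.basisFun F _ i) (Pi.basisFun F _ j)) * (X i * X j), ?_, fun x => ?_⟩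
  · refine Submodule.sum_mem _ fun i _ => Submodule.sum_mem _ fun j _ => ?_
    exact ((isHomogeneous_X F i).mul (isHomogeneous_X F j)).C_mul _
  · have h : Q x = B x x := by
      rw [← LinearMap.BilinMap.toQuadraticMap_apply, QuadraticMap.toQuadraticMap_toBilin]
    rw [h, ← LinearMap.sum_repr_mul_repr_mul (Pi.basisFun F (Fin n)) (Pi.basisFun F (Fin n))]
    rw [Finsupp.sum_fintype _ _ (by simp)]
    simp only [map_sum, map_mul, eval_C, eval_X]
    refine Finset.sum_congr rfl fun i _ => ?_
    rw [Finsupp.sum_fintype _ _ (by simp)]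
    refine Finset.sum_congr rfl fun j _ => ?_
    simp
    ring

/-- Every homogeneous polynomial of degree `2` in `n` variables induces a quadratic form
on `F ^ n`. -/
theorem exists_eval_eq_of_homogeneous {n : ℕ} {p : MvPolynomial (Fin n) F}
    (hp : p ∈ homogeneousSubmodule (Fin n) F 2) :
    ∃ Q : QuadraticForm F (Fin n → F), ∀ x, eval x p = Q x := by
  have hlin : ∀ r ∈ homogeneousSubmodule (Fin n) F 1,
      ∃ l : Module.Dual F (Fin n → F), ∀ x, eval x r = l x := by
    intro r hr
    rw [homogeneousSubmodule_one_eq_span_X] at hr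
    induction hr using Submodule.span_induction with
    | mem r hr =>
      obtain ⟨i, rfl⟩ := hr
      exact ⟨LinearMap.proj i, fun x => by simp⟩
    | zero => exact ⟨0, fun x => by simp⟩
    | add a b _ _ ha hb =>
      obtain ⟨l, hl⟩ := ha
      obtain ⟨l', hl'⟩ := hb
      exact ⟨l + l', fun x => by simp [hl, hl']⟩
    | smul c a _ ha =>
      obtain ⟨l, hl⟩ := ha
      exact ⟨c • l, fun x => by simp [smul_eval, hl]⟩
  rw [← homogeneousSubmodule_one_pow, pow_two] at hp
  induction hp using Submodule.mul_induction_on' with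
  | mem_mul_mem a ha b hb =>
    obtain ⟨l, hl⟩ := hlin a ha
    obtain ⟨l', hl'⟩ := hlin b hb
    exact ⟨QuadraticMap.linMulLin l l', fun x => by simp [hl, hl']⟩
  | add a _ b _ ha hb =>
    obtain ⟨Q, hQ⟩ := ha
    obtain ⟨Q', hQ'⟩ := hb
    exact ⟨Q + Q', fun x => by simp [hQ, hQ']⟩

/-- A quadratic form in at least three variables over a finite field is isotropic. -/
theorem numZeros_ne_one [Finite F] {n : ℕ} (hn : 3 ≤ n) (Q : QuadraticForm F (Fin n → F)) :
    numZeros Q ≠ 1 := by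
  classical
  have := Fintype.ofFinite F
  obtain ⟨p, hp, hpQ⟩ := exists_homogeneous_eval_eq Q
  obtain ⟨c, hc⟩ := CharP.exists F
  have hprime : c.Prime := CharP.char_prime_of_ne_zero F (CharP.char_ne_zero_of_finite F c)
  have : Fact c.Prime := ⟨hprime⟩
  have hdeg : p.totalDegree < Fintype.card (Fin n) := by
    have := IsHomogeneous.totalDegree_le hp
    simp
    omega
  -- Chevalley–Warning: the degree is at most `2 < n`, so the characteristic divides the number of
  -- zeros.
  have h := char_dvd_card_solutions c hdeg
  rw [← Nat.card_eq_fintype_card] at h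
  simp only [hpQ] at h
  intro h1
  rw [numZeros] at h1
  rw [h1] at h
  exact hprime.one_lt.ne' (Nat.dvd_one.1 h)

variable {V U : Type*} [AddCommGroup V] [Module F V] [AddCommGroup U] [Module F U]

/-- The zero form is the only quadratic form on the zero space. -/
instance uniqueOfSubsingleton [Subsingleton U] : Unique (QuadraticForm F U) where
  default := 0
  uniq Q := by
    ext x
    rw [Subsingleton.elim x 0, QuadraticMap.map_zero, QuadraticMap.map_zero]

section sums

variable [Finite F]

theorem numZeros_eq (Q : QuadraticForm F V) :
    (numZeros Q : ℝ) = Nat.card V / Nat.card F + (Nat.card F - 1) * excess Q := by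
  have := two_le_card_real (F := F)
  have h : (Nat.card F : ℝ) - 1 ≠ 0 := by linarith
  rw [excess, mul_div_cancel₀ _ h]
  ring

theorem sum_excess_of_subsingleton [Subsingleton U] (φ : ℝ → ℝ) :
    ∑ Q : QuadraticForm F U, φ (excess Q) = φ (1 / Nat.card F) := by
  have h1 : numZeros (0 : QuadraticForm F U) = 1 := by
    rw [numZeros, Nat.card_eq_one_iff_unique]
    exact ⟨inferInstance, ⟨0, QuadraticMap.map_zero _⟩⟩
  have h2 := two_le_card_real (F := F)
  have h : (Nat.card F : ℝ) - 1 ≠ 0 := by linarith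
  rw [Fintype.sum_unique, Subsingleton.elim (default : QuadraticForm F U) 0, excess, h1]
  congr 1
  simp
  field_simp

theorem sum_excess_line [Subsingleton U] (φ : ℝ → ℝ) :
    ∑ Q : QuadraticForm F (F × U), φ (excess Q) =
      φ 1 + (Nat.card F - 1) * φ 0 := by
  classical
  have := Fintype.ofFinite F
  have : Finite U := Finite.of_subsingleton
  have hu : Unique (Module.Dual F U) :=
    ⟨⟨0⟩, fun l => LinearMap.ext fun x => by rw [Subsingleton.elim x 0, map_zero, map_zero]⟩
  have hu' : Unique (Module.Dual F U × QuadraticForm F U) := Unique.mk' _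
  have h2 := two_le_card_real (F := F)
  have h : (Nat.card F : ℝ) - 1 ≠ 0 := by linarith
  let e : F ≃ QuadraticForm F (F × U) :=
    ((Equiv.prodUnique F _).symm).trans extendEquiv
  have he : ∀ c x, e c x = c * (x.1 * x.1) := fun c x => by
    change extend c _ _ x = _
    rw [extend_apply, Subsingleton.elim x.2 0, map_zero, QuadraticMap.map_zero]
    ring
  have h0 : excess (e 0) = 1 := by
    have : numZeros (e 0) = Nat.card F := by
      simp [numZeros, he]
    rw [excess, this, Nat.card_prod, Nat.card_unique (α := U)]
    have := card_real_ne_zero (F := F)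
    push_cast
    field_simp
  have h1 : ∀ c, c ≠ 0 → excess (e c) = 0 := fun c hc => by
    have : numZeros (e c) = 1 := by
      rw [numZeros, Nat.card_eq_one_iff_unique]
      refine ⟨⟨fun x y => ?_⟩, ⟨0, by simp⟩⟩
      have hx := x.2
      have hy := y.2
      simp only [he, mul_eq_zero, hc, or_self, false_or] at hx hy
      exact Subtype.ext (Prod.ext (hx.trans hy.symm) (Subsingleton.elim _ _))
    rw [excess, this]
    simp
  rw [← Fintype.sum_equiv e (fun c => φ (excess (e c))) _ fun _ => rfl,
    ← Finset.add_sum_erase _ _ (Finset.mem_univ 0), h0]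
  rw [Finset.sum_congr rfl fun c hc => by rw [h1 c (Finset.ne_of_mem_erase hc)]]
  rw [Finset.sum_const, Finset.card_erase_of_mem (Finset.mem_univ _), Finset.card_univ,
    nsmul_eq_mul, Nat.cast_sub Fintype.card_pos, Nat.card_eq_fintype_card]
  simp

/-- The double count and `formSum_recursion` have the same shape, so the two smaller dimensions
determine the sum weighted by `numZeros Q - 1`; removing the weight is a separate matter. -/
theorem sum_excess_prod_prod {N K : ℕ}
    (ih1 : ∀ φ : ℝ → ℝ, ∑ Q : QuadraticForm F (F × (Fin N → F)), φ (excess Q) =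
      formSum (Nat.card F) ((Nat.card F : ℝ) ^ (N + 1)) (K + 1) φ)
    (ih2 : ∀ φ : ℝ → ℝ, ∑ Q : QuadraticForm F (Fin N → F), φ (excess Q) =
      formSum (Nat.card F) ((Nat.card F : ℝ) ^ N) K φ) (φ : ℝ → ℝ) :
    ∑ Q : QuadraticForm F (F × (F × (Fin N → F))), ((numZeros Q : ℝ) - 1) * φ (excess Q) =
      formSum (Nat.card F) ((Nat.card F : ℝ) ^ (N + 2)) (K + 1)
        (fun e => ((Nat.card F : ℝ) ^ (N + 2) / Nat.card F + (Nat.card F - 1) * e - 1) * φ e) := by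
  have hq := two_le_card_real (F := F)
  have h0 := card_real_ne_zero (F := F)
  rw [sum_numZeros_sub_one_mul, ih1 (fun e => φ (Nat.card F * e)),
    ih2 (fun e => φ (Nat.card F * e)), formSum_recursion hq]
  have e1 : (Nat.card F : ℝ) ^ (N + 2) / Nat.card F = (Nat.card F : ℝ) ^ (N + 1) := by
    field_simp
    ring
  have e2 : (Nat.card F : ℝ) ^ (N + 1) / Nat.card F = (Nat.card F : ℝ) ^ N := by
    field_simp
    ring
  have e3 : (Nat.card (Fin N → F) : ℝ) = (Nat.card F : ℝ) ^ N := by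
    rw [Nat.card_fun]; simp
  rw [e1, e2, e3]
  ring

theorem card_quadraticForm_plane :
    Nat.card (QuadraticForm F (F × (F × (Fin 0 → F)))) = Nat.card F ^ 3 := by
  rw [card_quadraticForm_prod, card_quadraticForm_prod]
  simp
  ring

/-- Anisotropic forms, those of excess `-1`, have weight zero in the double count and are invisible
to it. Their number follows from the total number `q ^ 3` of forms. -/
theorem sum_excess_plane
    (h : ∀ φ : ℝ → ℝ, ∑ Q : QuadraticForm F (F × (F × (Fin 0 → F))),
        ((numZeros Q : ℝ) - 1) * φ (excess Q) =
      formSum (Nat.card F) ((Nat.card F : ℝ) ^ 2) 2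
        (fun e => ((Nat.card F : ℝ) ^ 2 / Nat.card F + (Nat.card F - 1) * e - 1) * φ e))
    (φ : ℝ → ℝ) :
    ∑ Q : QuadraticForm F (F × (F × (Fin 0 → F))), φ (excess Q) =
      formSum (Nat.card F) ((Nat.card F : ℝ) ^ 2) 2 φ := by
  classical
  have hq := two_le_card_real (F := F)
  have h0 := card_real_ne_zero (F := F)
  have h1 : (Nat.card F : ℝ) - 1 ≠ 0 := by linarith
  have hx : (Nat.card F : ℝ) ^ 2 / Nat.card F = Nat.card F := by field_simp
  have hz : ∀ Q : QuadraticForm F (F × (F × (Fin 0 → F))),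
      (numZeros Q : ℝ) - 1 = (Nat.card F - 1) * (excess Q + 1) := fun Q => by
    rw [numZeros_eq, Nat.card_prod, Nat.card_prod, Nat.card_fun]
    simp
    field_simp
    ring
  have key : ∀ ψ : ℝ → ℝ, ∑ Q : QuadraticForm F (F × (F × (Fin 0 → F))), ψ (excess Q) =
      formSum (Nat.card F) ((Nat.card F : ℝ) ^ 2) 2 (fun e => if e = -1 then 0 else ψ e) +
      ((Finset.univ.filter fun Q : QuadraticForm F (F × (F × (Fin 0 → F))) =>
        excess Q = -1).card : ℝ) * ψ (-1) := fun ψ => by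
    -- This test function cancels the weight; at `e = -1` the division by zero yields `0`, so
    -- exactly the anisotropic forms are lost.
    have h2 := h fun e => ψ e / ((Nat.card F - 1) * (e + 1))
    have h3 : ∀ e : ℝ, ((Nat.card F : ℝ) - 1) * (e + 1) *
        (ψ e / ((Nat.card F - 1) * (e + 1))) = if e = -1 then 0 else ψ e := fun e => by
      split_ifs with he
      · simp [he]
      · have : e + 1 ≠ 0 := fun h => he (by linarith)
        field_simp
    have h4 : ∀ e : ℝ, (Nat.card F : ℝ) ^ 2 / Nat.card F + (Nat.card F - 1) * e - 1 =
        (Nat.card F - 1) * (e + 1) := fun e => by rw [hx]; ring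
    simp only [hz, h3, h4] at h2
    rw [← h2, ← nsmul_eq_mul, ← Finset.sum_const, Finset.sum_filter, ← Finset.sum_add_distrib]
    refine Finset.sum_congr rfl fun Q _ => ?_
    split_ifs with hQ <;> simp [hQ]
  -- The constant function gives the number of anisotropic forms.
  have h1' := key fun _ => 1
  rw [Finset.sum_const, Finset.card_univ, ← Nat.card_eq_fintype_card,
    card_quadraticForm_plane] at h1'
  have hne : (Nat.card F : ℝ) ≠ -1 := by linarith
  rw [key, formSum_two hq]
  rw [formSum_two hq] at *
  norm_num [hne] at h1' ⊢
  linear_combination -φ (-1) * h1'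

/-- The distribution of the excess of the quadratic forms on a space of dimension `N`. -/
theorem sum_excess (N K : ℕ) (hK : N < 2 * K) (φ : ℝ → ℝ) :
    ∑ Q : QuadraticForm F (Fin N → F), φ (excess Q) =
      formSum (Nat.card F) ((Nat.card F : ℝ) ^ N) K φ := by
  have hq := two_le_card_real (F := F)
  have hsucc : ∀ n, (F × (Fin n → F)) ≃ₗ[F] (Fin (n + 1) → F) := fun n =>
    LinearEquiv.ofFinrankEq _ _ (by simp [add_comm])
  induction N using Nat.twoStepInduction generalizing K φ with
  | zero =>
    rw [formSum_pow_eq hq (L := 1) (by norm_num) (by omega), pow_zero, formSum_zero,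
      sum_excess_of_subsingleton]
  | one =>
    rw [formSum_pow_eq hq (L := 1) (by norm_num) (by omega), pow_one, formSum_one hq,
      sum_excess_congr (hsucc 0), sum_excess_line]
  | more N ih1 ih2 =>
    have h : ∀ (K : ℕ) (_ : N < 2 * K) (φ : ℝ → ℝ), _ := fun K hK => sum_excess_prod_prod (F := F)
      (N := N) (K := K) (fun φ => by
        rw [← sum_excess_congr (hsucc N)]; exact ih2 (K + 1) (by omega) φ)
      (fun φ => ih1 K hK φ)
    let e : (F × (F × (Fin N → F))) ≃ₗ[F] (Fin (N + 2) → F) :=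
      LinearEquiv.ofFinrankEq _ _ (by simp; ring)
    rw [sum_excess_congr e]
    rcases N with _ | N
    · rw [formSum_pow_eq hq (L := 2) (by norm_num) (by omega)]
      exact sum_excess_plane (h 1 (by norm_num)) φ
    · obtain ⟨K, rfl⟩ : ∃ K', K = K' + 1 := ⟨K - 1, by omega⟩
      -- The test function divides out the weight. It is nonzero on actual forms by
      -- `numZeros_ne_one`, and `formSum_congr` handles the formula side.
      have h1 := h K (by omega) fun a =>
        φ a / ((Nat.card F : ℝ) ^ (N + 3) / Nat.card F + (Nat.card F - 1) * a - 1)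
      have h2 : ∀ Q : QuadraticForm F (F × (F × (Fin (N + 1) → F))), (numZeros Q : ℝ) - 1 =
          (Nat.card F : ℝ) ^ (N + 3) / Nat.card F + (Nat.card F - 1) * excess Q - 1 := fun Q => by
        rw [numZeros_eq, Nat.card_congr e.toEquiv, Nat.card_fun]
        simp
      have h3 : ∀ Q : QuadraticForm F (F × (F × (Fin (N + 1) → F))),
          (numZeros Q : ℝ) - 1 ≠ 0 := fun Q => by
        rw [sub_ne_zero]
        norm_cast
        rw [← numZeros_comp_equiv Q e.symm]
        exact numZeros_ne_one (by omega) _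
      rw [Finset.sum_congr rfl fun Q _ => by
        rw [← h2, mul_div_cancel₀ _ (h3 Q)]] at h1
      rw [h1]
      exact formSum_congr hq N _ fun a ha => mul_div_cancel₀ _ ha

end sums

end QuadraticForm

/-! ### Inequalities between the counts. -/

namespace QuadraticCount

variable {q : ℝ}

theorem evenCount_pow_nonneg (hq : 2 ≤ q) {ε : ℝ} (hε : -1 ≤ ε) (N h : ℕ) :
    0 ≤ evenCount q ε (q ^ N) h := by
  rcases lt_or_ge N (2 * h) with hN | hN
  · rw [evenCount_pow_eq_zero hq _ hN]
  · have h1 := evenProd_pos hq h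
    have h2 := descProd_pow_pos hq hN
    have h3 : 1 ≤ q ^ h := one_le_pow₀ (by linarith)
    have h4 : 0 ≤ q ^ h + ε := by linarith
    unfold evenCount
    positivity

theorem evenCount_pow_pos (hq : 2 ≤ q) {ε : ℝ} {N h : ℕ} (hε : 0 < q ^ h + ε) (hN : 2 * h ≤ N) :
    0 < evenCount q ε (q ^ N) h := by
  have h1 := evenProd_pos hq h
  have h2 := descProd_pow_pos hq hN
  unfold evenCount
  positivity

theorem oddCount_pow_pos (hq : 2 ≤ q) {N h : ℕ} (hN : 2 * h + 1 ≤ N) :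
    0 < oddCount q (q ^ N) h := by
  have h1 := evenProd_pos hq h
  have h2 := descProd_pow_pos hq hN
  unfold oddCount
  positivity

/-- Log-concavity of a sequence follows from the decrease of its successive quotients. -/
theorem mul_le_sq_of_ratio {a b c u v s t : ℝ} (ha : 0 ≤ a) (hb : 0 ≤ b) (hv : 0 < v) (ht : 0 < t)
    (hab : b * v = a * u) (hbc : c * t = b * s) (h : s * v ≤ u * t) : a * c ≤ b ^ 2 := by
  have h1 : c = b * s / t := by rw [eq_div_iff ht.ne', hbc]
  have h2 : b = a * u / v := by rw [eq_div_iff hv.ne', hab]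
  have h3 : s / t ≤ u / v := by rw [div_le_div_iff₀ ht hv]; exact h
  calc a * c = b * (a * (s / t)) := by rw [h1]; ring
    _ ≤ b * (a * (u / v)) := by gcongr
    _ = b ^ 2 := by rw [← mul_div_assoc, ← h2]; ring

/-- For `ε = 1` the bound fails without the leading `q` on the right, since `q ^ 2 + 1 > 2 * q`. The
other factors of the quotient of counts leave room for this loss. -/
theorem typeFactor_le (hq : 2 ≤ q) {ε a : ℝ} (hε : ε = 1 ∨ ε = -1) (ha : 1 ≤ a) :
    (q * (q * a) + ε) * (a + ε) ≤ q * (q * a + ε) ^ 2 := by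
  rcases hε with rfl | rfl
  · nlinarith [mul_nonneg (by linarith : (0 : ℝ) ≤ q - 2) (by positivity : (0 : ℝ) ≤ a * q),
      mul_nonneg (by linarith : (0 : ℝ) ≤ q - 2) (by positivity : (0 : ℝ) ≤ a ^ 2 * q ^ 2),
      mul_nonneg (by linarith : (0 : ℝ) ≤ a - 1) (by positivity : (0 : ℝ) ≤ a)]
  · have h1 : (q * (q * a) + -1) * (a + -1) ≤ (q * a + -1) ^ 2 := by
      nlinarith [mul_nonneg (by linarith : (0 : ℝ) ≤ a) (sq_nonneg (q - 1))]
    nlinarith [sq_nonneg (q * a + -1)]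

theorem evenCount_logConcave (hq : 2 ≤ q) {ε : ℝ} (hε : ε = 1 ∨ ε = -1) {N h : ℕ}
    (h0 : 0 < q ^ h + ε) (hN : 2 * h + 4 ≤ N) :
    evenCount q ε (q ^ N) h * evenCount q ε (q ^ N) (h + 2) ≤
      evenCount q ε (q ^ N) (h + 1) ^ 2 := by
  have hε1 : -1 ≤ ε := by rcases hε with rfl | rfl <;> norm_num
  have hq1 : 1 ≤ q := by linarith
  have ha : 1 ≤ q ^ h := one_le_pow₀ hq1
  have h1 : q ^ h ≤ q ^ (h + 1) := pow_le_pow_right₀ hq1 (by omega)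
  have h2 := evenFactor_pos hq h
  have h3 := evenFactor_pos hq (h + 1)
  refine mul_le_sq_of_ratio (evenCount_pow_nonneg hq hε1 N h) (evenCount_pow_nonneg hq hε1 N _)
    (mul_pos h0 h2) (mul_pos (by linarith) h3) (evenCount_succ_mul hq ε _ h)
    (evenCount_succ_mul hq ε _ (h + 1)) ?_
  have hy : q ^ 4 ≤ q ^ N / q ^ (2 * h) := by
    rw [le_div_iff₀ (by positivity), ← pow_add]
    exact pow_le_pow_right₀ hq1 (by omega)
  have e1 : q ^ N / q ^ (2 * h + 1) = q ^ N / q ^ (2 * h) / q := by rw [pow_succ, div_div]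
  have e2 : q ^ N / q ^ (2 * (h + 1)) = q ^ N / q ^ (2 * h) / q ^ 2 := by
    rw [div_div, ← pow_add]; ring_nf
  have e3 : q ^ N / q ^ (2 * (h + 1) + 1) = q ^ N / q ^ (2 * h) / q ^ 3 := by
    rw [div_div, ← pow_add]; ring_nf
  rw [e1, e2, e3]
  have f1 := typeFactor_le hq hε ha
  have f2 : q ^ 2 * (q ^ (2 * h + 2) - 1) ≤ q ^ (2 * (h + 1) + 2) - 1 := by
    have : q ^ (2 * (h + 1) + 2) = q ^ 2 * q ^ (2 * h + 2) := by ring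
    rw [this]
    nlinarith
  generalize q ^ N / q ^ (2 * h) = y at *
  have g : ∀ z : ℝ, z / q ^ 2 - 1 ≤ (z - 1) / q ^ 2 := fun z => by
    rw [sub_div]
    have : 1 / q ^ 2 ≤ 1 := by
      rw [div_le_one (by positivity)]
      exact one_le_pow₀ hq1
    linarith
  have g1 := g y
  have g2 := g (y / q)
  have e4 : y / q / q ^ 2 = y / q ^ 3 := by rw [div_div]; ring_nf
  rw [e4] at g2
  have hy3 : 0 ≤ y / q ^ 3 - 1 := by
    rw [sub_nonneg, one_le_div (by positivity)]
    exact (pow_le_pow_right₀ hq1 (by omega)).trans hy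
  have hy1 : 0 ≤ y - 1 := sub_nonneg.2 ((one_le_pow₀ hq1).trans hy)
  have f3 : (y / q ^ 2 - 1) * (y / q ^ 3 - 1) ≤ (y - 1) / q ^ 2 * ((y / q - 1) / q ^ 2) :=
    mul_le_mul g1 g2 hy3 (by positivity)
  have hy2 : 0 ≤ y / q - 1 := by
    rw [sub_nonneg, one_le_div (by positivity)]
    exact (le_self_pow₀ hq1 (by omega)).trans hy
  have p1 : 0 ≤ q ^ (h + 1) + ε := by linarith
  have p2 : 0 ≤ q ^ (h + 1 + 1) + ε := by
    have : 1 ≤ q ^ (h + 1 + 1) := one_le_pow₀ hq1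
    linarith
  have f1' : (q ^ (h + 1 + 1) + ε) * (q ^ h + ε) ≤ q * (q ^ (h + 1) + ε) ^ 2 := by
    have e5 : q ^ (h + 1 + 1) = q * (q * q ^ h) := by ring
    have e6 : q ^ (h + 1) = q * q ^ h := by ring
    rw [e5, e6]
    exact f1
  calc (q ^ (h + 1 + 1) + ε) * q ^ (2 * (h + 1) + 1) *
        ((y / q ^ 2 - 1) * (y / q ^ 3 - 1)) * ((q ^ h + ε) * (q ^ (2 * h + 2) - 1))
      = ((q ^ (h + 1 + 1) + ε) * (q ^ h + ε)) * (q ^ (2 * h + 1) *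
        ((y / q ^ 2 - 1) * (y / q ^ 3 - 1)) * (q ^ 2 * (q ^ (2 * h + 2) - 1))) := by ring
    _ ≤ (q * (q ^ (h + 1) + ε) ^ 2) * (q ^ (2 * h + 1) *
        ((y - 1) / q ^ 2 * ((y / q - 1) / q ^ 2)) * (q ^ (2 * (h + 1) + 2) - 1)) := by
      have hy4 : 0 ≤ y / q ^ 2 - 1 := hy3.trans (sub_le_sub_right
        (div_le_div_of_nonneg_left (by linarith) (by positivity)
          (pow_le_pow_right₀ hq1 (by norm_num))) _)
      gcongr
    _ = ((q ^ (h + 1) + ε) ^ 2 * q ^ (2 * h + 1) * ((y - 1) * (y / q - 1)) *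
        (q ^ (2 * (h + 1) + 2) - 1)) * (q / q ^ 4) := by ring
    _ ≤ ((q ^ (h + 1) + ε) ^ 2 * q ^ (2 * h + 1) * ((y - 1) * (y / q - 1)) *
        (q ^ (2 * (h + 1) + 2) - 1)) * 1 := by
      -- The factor `q` lost in `typeFactor_le` is absorbed by the two factors `1 / q ^ 2` gained in
      -- `f3`.
      have : q / q ^ 4 ≤ 1 := by
        rw [div_le_one (by positivity)]
        exact le_self_pow₀ hq1 (by omega)
      gcongr
    _ = _ := by ring

theorem oddCount_le_half_succ (hq : 2 ≤ q) {M h : ℕ} (h1 : h < M) :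
    2 * oddCount q (q ^ (2 * M + 1)) h ≤ oddCount q (q ^ (2 * M + 1)) (h + 1) := by
  have hq1 : 1 ≤ q := by linarith
  have h2 := evenFactor_pos hq h
  have h3 := oddCount_succ_mul hq (q ^ (2 * M + 1)) h
  have h4 := oddCount_pow_pos hq (N := 2 * M + 1) (h := h) (by omega)
  have h5 : q ^ 2 ≤ q ^ (2 * M + 1) / q ^ (2 * h + 1) := by
    rw [le_div_iff₀ (by positivity), ← pow_add]
    exact pow_le_pow_right₀ hq1 (by omega)
  have h6 : q ≤ q ^ (2 * M + 1) / q ^ (2 * h + 2) := by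
    rw [le_div_iff₀ (by positivity), ← pow_succ']
    exact pow_le_pow_right₀ hq1 (by omega)
  have h7 : 3 * 1 ≤ (q ^ (2 * M + 1) / q ^ (2 * h + 1) - 1) *
      (q ^ (2 * M + 1) / q ^ (2 * h + 2) - 1) := by
    refine mul_le_mul ?_ ?_ (by norm_num) ?_ <;> nlinarith
  refine le_of_mul_le_mul_right ?_ h2
  rw [h3]
  calc 2 * oddCount q (q ^ (2 * M + 1)) h * (q ^ (2 * h + 2) - 1)
      = oddCount q (q ^ (2 * M + 1)) h * ((q ^ (2 * h + 2) - 1) * 2) := by ring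
    _ ≤ oddCount q (q ^ (2 * M + 1)) h * (q ^ (2 * h + 2) *
        ((q ^ (2 * M + 1) / q ^ (2 * h + 1) - 1) *
        (q ^ (2 * M + 1) / q ^ (2 * h + 2) - 1))) := by
      gcongr
      · linarith
      · linarith

theorem oddCount_le_oddTotal (hq : 2 ≤ q) (M : ℕ) :
    oddCount q (q ^ (2 * M + 1)) M ≤ oddTotal q (q ^ (2 * M + 1)) (M + 1) :=
  Finset.single_le_sum (f := fun h => oddCount q (q ^ (2 * M + 1)) h)
    (fun h hh => (oddCount_pow_pos hq (by have := Finset.mem_range.1 hh; omega)).le)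
    (Finset.self_mem_range_succ M)

/-- The odd counts at least double with each step in the rank, so their sum is bounded by a
geometric series ending at the top one. -/
theorem oddTotal_le (hq : 2 ≤ q) (M : ℕ) :
    oddTotal q (q ^ (2 * M + 1)) (M + 1) ≤ 2 * oddCount q (q ^ (2 * M + 1)) M := by
  have h : ∀ h ≤ M, oddTotal q (q ^ (2 * M + 1)) (h + 1) ≤
      2 * oddCount q (q ^ (2 * M + 1)) h := by
    intro h hh
    induction h with
    | zero =>
      have := oddCount_pow_pos hq (N := 2 * M + 1) (h := 0) (by omega)
      rw [oddTotal, Finset.sum_range_one]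
      linarith
    | succ h ih =>
      have h1 := ih (by omega)
      have h2 := oddCount_le_half_succ hq (M := M) (h := h) (by omega)
      rw [oddTotal] at h1
      rw [oddTotal, Finset.sum_range_succ]
      linarith
  exact h M le_rfl

theorem top_factor_eq (hq : 2 ≤ q) (M : ℕ) : q ^ (2 * M + 1) / q ^ (2 * M) = q := by
  rw [pow_succ, mul_div_cancel_left₀ _ (by positivity)]

/-- The top odd count alone suffices: up to a common square, the comparison is `(q ^ (2 * M) - 1) /
4 ≤ q ^ (2 * M) * (q - 1) ^ 2`. -/
theorem evenCount_mul_evenCount_le_sq (hq : 2 ≤ q) (M : ℕ) :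
    evenCount q 1 (q ^ (2 * M + 1)) M * evenCount q (-1) (q ^ (2 * M + 1)) M ≤
      oddTotal q (q ^ (2 * M + 1)) (M + 1) ^ 2 := by
  have h1 := oddCount_le_oddTotal hq M
  have h2 := oddCount_pow_pos hq (N := 2 * M + 1) (h := M) le_rfl
  refine le_trans ?_ (pow_le_pow_left₀ h2.le h1 2)
  rw [oddCount, evenCount, evenCount, descProd_succ, top_factor_eq hq,
    show M * (M + 1) = M ^ 2 + M by ring, pow_add q (M ^ 2) M]
  have e : ∀ A B D E : ℝ, (A + 1) / 2 * B * D / E * ((A + -1) / 2 * B * D / E) =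
      (B * D / E) ^ 2 * ((A ^ 2 - 1) / 4) := fun A B D E => by ring
  have e' : ∀ A B D E : ℝ, (B * A * (D * (q - 1)) / E) ^ 2 =
      (B * D / E) ^ 2 * (A ^ 2 * (q - 1) ^ 2) := fun A B D E => by ring
  rw [e, e']
  refine mul_le_mul_of_nonneg_left ?_ (sq_nonneg _)
  nlinarith [sq_nonneg (q ^ M), mul_nonneg (sq_nonneg (q ^ M))
    (by nlinarith : 0 ≤ (q - 1) ^ 2 - 1)]

/-- What the quotient criterion requires next to the middle, with `a = q ^ M`. The `4` is the `2` of
`oddTotal_le` times the `2` of `oddCount_mul`. -/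
theorem top_ratio_le (hq : 2 ≤ q) {ε a : ℝ} (hε : ε = 1 ∨ ε = -1) (ha : 1 ≤ a) :
    4 * q ^ 2 * (a * (a + ε)) ≤ (q * a + ε) ^ 2 * ((q ^ 3 - 1) * (q + 1)) := by
  have h1 : 8 ≤ q ^ 3 := by
    calc (8 : ℝ) = 2 ^ 3 := by norm_num
      _ ≤ q ^ 3 := by gcongr
  rcases hε with rfl | rfl
  · have h2 : q * (a * (a + 1)) ≤ (q * a + 1) ^ 2 := by
      nlinarith [mul_nonneg (by linarith : (0 : ℝ) ≤ q - 2) (by positivity : (0 : ℝ) ≤ a ^ 2 * q)]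
    have h3 : 4 * q ≤ (q ^ 3 - 1) * (q + 1) := by nlinarith
    calc 4 * q ^ 2 * (a * (a + 1)) = q * (a * (a + 1)) * (4 * q) := by ring
      _ ≤ _ := by gcongr
  · have h2 : (q * (a - 1)) * ((q - 1) * a) ≤ (q * a + -1) * (q * a + -1) := by
      have : 0 ≤ (q - 1) * a := mul_nonneg (by linarith) (by linarith)
      exact mul_le_mul (by linarith) (by linarith) this (by nlinarith)
    have h3 : 4 * q ≤ (q - 1) * ((q ^ 3 - 1) * (q + 1)) := by
      nlinarith [mul_nonneg (by linarith : (0 : ℝ) ≤ q ^ 3 - 8)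
        (by nlinarith : (0 : ℝ) ≤ (q - 1) * (q + 1))]
    have h4 : 0 ≤ a * (a - 1) := mul_nonneg (by linarith) (by linarith)
    have h5 : 0 ≤ (q ^ 3 - 1) * (q + 1) := mul_nonneg (by linarith) (by linarith)
    calc 4 * q ^ 2 * (a * (a + -1)) = q * (a * (a - 1)) * (4 * q) := by ring
      _ ≤ q * (a * (a - 1)) * ((q - 1) * ((q ^ 3 - 1) * (q + 1))) := by gcongr
      _ = (q * (a - 1)) * ((q - 1) * a) * ((q ^ 3 - 1) * (q + 1)) := by ring
      _ ≤ (q * a + -1) * (q * a + -1) * ((q ^ 3 - 1) * (q + 1)) := by gcongr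
      _ = _ := by ring

/-- Replacing the odd total by twice its top term makes it an explicit multiple of the even count of
index `M + 1`, so the quotient criterion applies. -/
theorem evenCount_mul_oddTotal_le_sq (hq : 2 ≤ q) {ε : ℝ} (hε : ε = 1 ∨ ε = -1) {M : ℕ}
    (h0 : 0 < q ^ M + ε) :
    evenCount q ε (q ^ (2 * (M + 1) + 1)) M *
        oddTotal q (q ^ (2 * (M + 1) + 1)) (M + 1 + 1) ≤
      evenCount q ε (q ^ (2 * (M + 1) + 1)) (M + 1) ^ 2 := by
  have hε1 : -1 ≤ ε := by rcases hε with rfl | rfl <;> norm_num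
  have hq1 : 1 ≤ q := by linarith
  have h1 := oddTotal_le hq (M + 1)
  have h2 := oddCount_mul q (q ^ (2 * (M + 1) + 1)) (M + 1) ε
  have h3 := evenCount_succ_mul hq ε (q ^ (2 * (M + 1) + 1)) M
  have h4 := evenFactor_pos hq M
  have h5 := evenCount_pow_nonneg hq hε1 (2 * (M + 1) + 1) M
  have h6 := evenCount_pow_nonneg hq hε1 (2 * (M + 1) + 1) (M + 1)
  have h7 : q ^ M ≤ q ^ (M + 1) := pow_le_pow_right₀ hq1 (by omega)
  have h8 : 0 < q ^ (M + 1) + ε := by linarith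
  refine (mul_le_mul_of_nonneg_left h1 h5).trans ?_
  have h2' : 2 * oddCount q (q ^ (2 * (M + 1) + 1)) (M + 1) * (q ^ (M + 1) + ε) =
      evenCount q ε (q ^ (2 * (M + 1) + 1)) (M + 1) * (4 * q ^ (M + 1) * (q - 1)) := by
    rw [mul_assoc, h2, top_factor_eq hq]; ring
  refine mul_le_sq_of_ratio h5 h6 (mul_pos h0 h4) h8 h3 h2' ?_
  have e1 : q ^ (2 * (M + 1) + 1) / q ^ (2 * M) = q ^ 3 := by
    rw [div_eq_iff (by positivity), ← pow_add]; ring_nf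
  have e2 : q ^ (2 * (M + 1) + 1) / q ^ (2 * M + 1) = q ^ 2 := by
    rw [div_eq_iff (by positivity), ← pow_add]; ring_nf
  have e3 : q ^ (M + 1) = q * q ^ M := pow_succ' _ _
  have h9 := top_ratio_le hq hε (one_le_pow₀ hq1 : 1 ≤ q ^ M)
  rw [e1, e2, e3]
  calc 4 * (q * q ^ M) * (q - 1) * ((q ^ M + ε) * (q ^ (2 * M + 2) - 1))
      ≤ 4 * (q * q ^ M) * (q - 1) * ((q ^ M + ε) * q ^ (2 * M + 2)) := by
        have : 0 ≤ q - 1 := by linarith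
        gcongr
        linarith
    _ = (4 * q ^ 2 * (q ^ M * (q ^ M + ε))) * (q ^ (2 * M + 1) * (q - 1)) := by ring
    _ ≤ ((q * q ^ M + ε) ^ 2 * ((q ^ 3 - 1) * (q + 1))) * (q ^ (2 * M + 1) * (q - 1)) := by
        have : 0 ≤ q - 1 := by linarith
        gcongr
    _ = _ := by ring

/-! ### One sequence ordered by weight: hyperbolic, odd, elliptic. -/

/-- The values of the excess of the quadratic forms in `2 M + 1` variables, in decreasing order. -/
noncomputable def excessValue (q : ℝ) (M j : ℕ) : ℝ :=
  if j ≤ M then q ^ (2 * M - j) else if j = M + 1 then 0 else -q ^ (j - 2)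

/-- The number of quadratic forms in `2 M + 1` variables with the excess `excessValue q M j`. -/
noncomputable def excessCount (q : ℝ) (M j : ℕ) : ℝ :=
  if j ≤ M then evenCount q 1 (q ^ (2 * M + 1)) j
  else if j = M + 1 then oddTotal q (q ^ (2 * M + 1)) (M + 1)
  else evenCount q (-1) (q ^ (2 * M + 1)) (2 * M + 2 - j)

theorem excessCount_of_le {M j : ℕ} (h : j ≤ M) :
    excessCount q M j = evenCount q 1 (q ^ (2 * M + 1)) j :=
  if_pos h

theorem excessCount_middle (q : ℝ) (M : ℕ) :
    excessCount q M (M + 1) = oddTotal q (q ^ (2 * M + 1)) (M + 1) := by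
  simp [excessCount]

theorem excessCount_of_lt {M j : ℕ} (h : M + 1 < j) :
    excessCount q M j = evenCount q (-1) (q ^ (2 * M + 1)) (2 * M + 2 - j) := by
  rw [excessCount, if_neg (by omega), if_neg (by omega)]

theorem formSum_eq_sum_excessCount (hq : 2 ≤ q) (M : ℕ) (φ : ℝ → ℝ) :
    formSum q (q ^ (2 * M + 1)) (M + 1) φ =
      ∑ j ∈ Finset.range (2 * M + 2), excessCount q M j * φ (excessValue q M j) := by
  have hdiv : ∀ h ≤ M, ∀ ε : ℝ, ε * q ^ (2 * M + 1) / q ^ (h + 1) = ε * q ^ (2 * M - h) :=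
    fun h hh ε => by
      rw [div_eq_iff (by positivity), mul_assoc, ← pow_add]
      congr 2
      omega
  rw [show 2 * M + 2 = M + 1 + 1 + M by ring, Finset.sum_range_add, Finset.sum_range_succ, formSum]
  have h1 : evenSum q 1 (q ^ (2 * M + 1)) (M + 1) φ =
      ∑ j ∈ Finset.range (M + 1), excessCount q M j * φ (excessValue q M j) := by
    refine Finset.sum_congr rfl fun h hh => ?_
    have hh : h ≤ M := by have := Finset.mem_range.1 hh; omega
    rw [hdiv h hh, excessCount, excessValue, if_pos hh, if_pos hh, one_mul]
  have h2 : evenSum q (-1) (q ^ (2 * M + 1)) (M + 1) φ = ∑ k ∈ Finset.range M,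
      excessCount q M (M + 1 + 1 + k) * φ (excessValue q M (M + 1 + 1 + k)) := by
    -- There is no elliptic form of rank zero; the `M` remaining terms are reversed, as the elliptic
    -- excess increases with the rank.
    rw [evenSum, Finset.sum_range_succ', evenCount_zero_neg_one, zero_mul, add_zero,
      ← Finset.sum_range_reflect]
    refine Finset.sum_congr rfl fun k hk => ?_
    have hk := Finset.mem_range.1 hk
    rw [hdiv _ (by omega), excessCount, excessValue, if_neg (by omega), if_neg (by omega),
      if_neg (by omega), if_neg (by omega), neg_one_mul]
    congr 3
    · omega
    · congr 1; omega
  have h3 : oddTotal q (q ^ (2 * M + 1)) (M + 1) * φ 0 =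
      excessCount q M (M + 1) * φ (excessValue q M (M + 1)) := by
    simp [excessCount, excessValue]
  rw [h1, h2, h3]
  ring

theorem excessValue_lt (hq : 2 ≤ q) {M i j : ℕ} (hij : i < j) (hj : j < 2 * M + 2) :
    excessValue q M j < excessValue q M i := by
  have hq1 : 1 < q := by linarith
  have hpos : ∀ n, 0 < q ^ n := fun n => by positivity
  unfold excessValue
  split_ifs with h1 h2 h3 h4 h5 h6 h7 h8 <;> try omega
  · exact pow_lt_pow_right₀ hq1 (by omega)
  · exact hpos _
  · linarith [hpos (j - 2), hpos (2 * M - i)]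
  · linarith [hpos (j - 2)]
  · exact neg_lt_neg (pow_lt_pow_right₀ hq1 (by omega))

theorem excessCount_pos (hq : 2 ≤ q) {M j : ℕ} (hj : j < 2 * M + 2) :
    0 < excessCount q M j := by
  unfold excessCount
  split_ifs with h1 h2
  · exact evenCount_pow_pos hq (by positivity) (by omega)
  · exact (oddCount_pow_pos hq le_rfl).trans_le (oddCount_le_oddTotal hq M)
  · refine evenCount_pow_pos hq ?_ (by omega)
    linarith [one_lt_pow₀ (by linarith : 1 < q) (by omega : 2 * M + 2 - j ≠ 0)]

/-- The cases are the positions of the odd total relative to the triple: after it, last, middle,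
first, before it. On the elliptic side the rank decreases along the sequence, so the product is
commuted. -/
theorem excessCount_logConcave (hq : 2 ≤ q) {M i : ℕ} (hM : 1 ≤ M) (hi : i + 2 < 2 * M + 2) :
    excessCount q M i * excessCount q M (i + 2) ≤ excessCount q M (i + 1) ^ 2 := by
  have hpos : ∀ n, 0 < q ^ n + 1 := fun n => by positivity
  have hneg : ∀ n, n ≠ 0 → 0 < q ^ n + -1 := fun n hn => by
    linarith [one_lt_pow₀ (by linarith : 1 < q) hn]
  obtain ⟨K, rfl⟩ : ∃ K, M = K + 1 := ⟨M - 1, by omega⟩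
  rcases lt_trichotomy (i + 1) (K + 1) with h | h | h
  · rw [excessCount_of_le (by omega), excessCount_of_le (by omega), excessCount_of_le (by omega)]
    exact evenCount_logConcave hq (Or.inl rfl) (hpos i) (by omega)
  · obtain rfl : i = K := by omega
    rw [excessCount_of_le (by omega), excessCount_of_le le_rfl, excessCount_middle]
    exact evenCount_mul_oddTotal_le_sq hq (Or.inl rfl) (hpos i)
  · rcases eq_or_lt_of_le (Nat.succ_le_of_lt h) with h | h
    · obtain rfl : i = K + 1 := by omega
      rw [excessCount_of_le le_rfl, excessCount_middle, excessCount_of_lt (by omega),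
        show 2 * (K + 1) + 2 - (K + 1 + 2) = K + 1 by omega]
      exact evenCount_mul_evenCount_le_sq hq (K + 1)
    · rcases eq_or_lt_of_le (Nat.succ_le_of_lt h) with h | h
      · obtain rfl : i = K + 1 + 1 := by omega
        rw [excessCount_middle, excessCount_of_lt (by omega), excessCount_of_lt (by omega),
          mul_comm, show 2 * (K + 1) + 2 - (K + 1 + 1 + 2) = K by omega,
          show 2 * (K + 1) + 2 - (K + 1 + 1 + 1) = K + 1 by omega]
        exact evenCount_mul_oddTotal_le_sq hq (Or.inr rfl) (hneg K (by omega))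
      · obtain ⟨h, hh⟩ : ∃ h, 2 * (K + 1) + 2 - (i + 2) = h := ⟨_, rfl⟩
        rw [excessCount_of_lt (by omega), excessCount_of_lt (by omega),
          excessCount_of_lt (by omega), mul_comm,
          hh, show 2 * (K + 1) + 2 - (i + 1) = h + 1 by omega,
          show 2 * (K + 1) + 2 - i = h + 2 by omega]
        exact evenCount_logConcave hq (Or.inr rfl) (hneg h (by omega)) (by omega)

/-- The weights of the projective Reed-Muller code of order `2` in dimension `2 M`. -/
def weightValue (q M j : ℕ) : ℕ :=
  if j ≤ M then q ^ (2 * M) - q ^ (2 * M - j)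
  else if j = M + 1 then q ^ (2 * M) else q ^ (2 * M) + q ^ (j - 2)

theorem weightValue_cast {q : ℕ} (hq : 1 ≤ q) (M j : ℕ) :
    (weightValue q M j : ℝ) = (q : ℝ) ^ (2 * M) - excessValue q M j := by
  unfold weightValue excessValue
  split_ifs
  · rw [Nat.cast_sub (Nat.pow_le_pow_right hq (by omega))]
    push_cast
    rfl
  · simp
  · push_cast
    ring

end QuadraticCount

/-! ### From quadratic forms to codewords and weights. -/

namespace LinearCode

open QuadraticForm QuadraticCount

variable {F : Type*} [Field F]

theorem mem_projectiveReedMuller_two {m : ℕ}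
    {r : ℙ F (Fin (m + 1) → F) → (Fin (m + 1) → F)} {c : ℙ F (Fin (m + 1) → F) → F} :
    c ∈ projectiveReedMuller 2 m r ↔
      ∃ Q : QuadraticForm F (Fin (m + 1) → F), (fun P => Q (r P)) = c := by
  rw [projectiveReedMuller, Submodule.mem_map]
  constructor
  · rintro ⟨p, hp, rfl⟩
    obtain ⟨Q, hQ⟩ := exists_eval_eq_of_homogeneous hp
    refine ⟨Q, funext fun P => ?_⟩
    simp [← hQ, MvPolynomial.aeval_eq_eval]
  · rintro ⟨Q, rfl⟩
    obtain ⟨p, hp, hpQ⟩ := exists_homogeneous_eval_eq Q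
    refine ⟨p, hp, funext fun P => ?_⟩
    simp [← hpQ, MvPolynomial.aeval_eq_eval]

section

variable {m : ℕ} {r : ℙ F (Fin (m + 1) → F) → (Fin (m + 1) → F)}

theorem exists_smul_representative
    (hr : ∀ P, ∃ h : r P ≠ 0, Projectivization.mk F (r P) h = P)
    {v : Fin (m + 1) → F} (hv : v ≠ 0) :
    ∃ (P : ℙ F (Fin (m + 1) → F)) (a : Fˣ), a • r P = v := by
  obtain ⟨h, hP⟩ := hr (Projectivization.mk F v hv)
  obtain ⟨a, ha⟩ := (Projectivization.mk_eq_mk_iff F _ _ hv h).1 hP.symm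
  exact ⟨_, a, ha⟩

theorem eval_representative_injective
    (hr : ∀ P, ∃ h : r P ≠ 0, Projectivization.mk F (r P) h = P)
    :
    Function.Injective fun (Q : QuadraticForm F (Fin (m + 1) → F)) P => Q (r P) := by
  intro Q Q' h
  ext v
  by_cases hv : v = 0
  · simp [hv]
  · obtain ⟨P, a, rfl⟩ := exists_smul_representative hr hv
    rw [Units.smul_def, QuadraticMap.map_smul, QuadraticMap.map_smul]
    exact congrArg _ (congrFun h P)

/-- Each vector with `Q v ≠ 0` is uniquely a unit times a representative, and `Q (a • v) = a ^ 2 * Q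
v`. Hence the weight times `q - 1` is the number of non-zeros of `Q`, whatever the representatives.
-/
theorem hammingNorm_eval_representative
    (hr : ∀ P, ∃ h : r P ≠ 0, Projectivization.mk F (r P) h = P)
    [Finite F] [DecidableEq F]
    [Fintype (ℙ F (Fin (m + 1) → F))] (Q : QuadraticForm F (Fin (m + 1) → F)) :
    (hammingNorm (fun P => Q (r P)) : ℝ) = (Nat.card F : ℝ) ^ m - excess Q := by
  have hq := two_le_card_real (F := F)
  have h1 : hammingNorm (fun P => Q (r P)) = Nat.card {P // Q (r P) ≠ 0} := by
    rw [hammingNorm, Nat.card_eq_fintype_card, Fintype.card_subtype]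
  have h2 : Nat.card {P // Q (r P) ≠ 0} * Nat.card Fˣ = Nat.card {v // Q v ≠ 0} := by
    rw [← Nat.card_prod]
    refine Nat.card_congr (Equiv.ofBijective
      (fun x => ⟨x.2 • r x.1.1, ?_⟩) ⟨?_, ?_⟩)
    · rw [Units.smul_def, QuadraticMap.map_smul, smul_eq_mul]
      exact mul_ne_zero (mul_ne_zero x.2.ne_zero x.2.ne_zero) x.1.2
    · rintro ⟨⟨P, hP⟩, a⟩ ⟨⟨P', hP'⟩, a'⟩ h
      have h : a • r P = a' • r P' := congrArg Subtype.val h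
      obtain ⟨h0, hmk⟩ := hr P
      obtain ⟨h0', hmk'⟩ := hr P'
      have hPP : P = P' := by
        rw [← hmk, ← hmk', Projectivization.mk_eq_mk_iff]
        exact ⟨a⁻¹ * a', by rw [mul_smul, ← h, inv_smul_smul]⟩
      subst hPP
      have ha : (a : F) = a' := smul_left_injective F h0 h
      simp [Units.ext ha]
    · rintro ⟨v, hv⟩
      obtain ⟨P, a, rfl⟩ := exists_smul_representative hr
        (v := v) (by rintro rfl; simp at hv)
      refine ⟨(⟨P, fun h => hv ?_⟩, a), rfl⟩
      rw [Units.smul_def, QuadraticMap.map_smul, h, smul_zero]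
  have h3 : Nat.card {v // Q v ≠ 0} + numZeros Q = Nat.card F ^ (m + 1) := by
    have := Fintype.ofFinite F
    rw [numZeros, Nat.card_eq_fintype_card, Nat.card_eq_fintype_card, add_comm,
      Fintype.card_subtype_compl, Nat.add_sub_cancel' (Fintype.card_subtype_le _)]
    simp [Nat.card_eq_fintype_card]
  have h4 : Nat.card Fˣ + 1 = Nat.card F := by
    have := Fintype.ofFinite F
    have : 0 < Fintype.card F := Fintype.card_pos
    rw [Nat.card_eq_fintype_card, Nat.card_eq_fintype_card, Fintype.card_units]
    omega
  rw [← h1] at h2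
  have h2' : (hammingNorm (fun P => Q (r P)) : ℝ) * Nat.card Fˣ = Nat.card {v // Q v ≠ 0} := by
    exact_mod_cast h2
  have h3' : (Nat.card {v // Q v ≠ 0} : ℝ) + numZeros Q = (Nat.card F : ℝ) ^ (m + 1) := by
    exact_mod_cast h3
  have h4' : (Nat.card Fˣ : ℝ) + 1 = Nat.card F := by exact_mod_cast h4
  have h5 := numZeros_eq Q
  have h6 : (Nat.card (Fin (m + 1) → F) : ℝ) / Nat.card F = (Nat.card F : ℝ) ^ m := by
    rw [Nat.card_fun, Nat.card_fin, div_eq_iff (by linarith)]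
    push_cast
    ring
  have h7 : (Nat.card F : ℝ) - 1 ≠ 0 := by linarith
  refine mul_right_cancel₀ h7 ?_
  rw [h6] at h5
  rw [← eq_sub_iff_add_eq] at h4'
  rw [← h4', h2', h4']
  linear_combination h3' - h5

theorem weightCount_projectiveReedMuller_two
    (hr : ∀ P, ∃ h : r P ≠ 0, Projectivization.mk F (r P) h = P)
    [Finite F] [DecidableEq F]
    [Fintype (ℙ F (Fin (m + 1) → F))] (i : ℕ) :
    (weightCount (projectiveReedMuller 2 m r) i : ℝ) =
      ∑ Q : QuadraticForm F (Fin (m + 1) → F),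
        if (Nat.card F : ℝ) ^ m - excess Q = i then 1 else 0 := by
  classical
  have h : weightCount (projectiveReedMuller 2 m r) i =
      Nat.card {Q : QuadraticForm F (Fin (m + 1) → F) //
        (Nat.card F : ℝ) ^ m - excess Q = i} := by
    refine (Nat.card_congr (Equiv.ofBijective (fun Q => ⟨fun P => Q.1 (r P),
      mem_projectiveReedMuller_two.2 ⟨Q.1, rfl⟩, ?_⟩) ⟨?_, ?_⟩)).symm
    rotate_right
    · have := Q.2
      rw [← hammingNorm_eval_representative hr] at this
      exact_mod_cast this
    · intro Q Q' hQ
      exact Subtype.ext (eval_representative_injective hr (congrArg Subtype.val hQ))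
    · rintro ⟨c, hc, hi⟩
      obtain ⟨Q, rfl⟩ := mem_projectiveReedMuller_two.1 hc
      exact ⟨⟨Q, by rw [← hammingNorm_eval_representative hr, hi]⟩, rfl⟩
  rw [h, Nat.card_eq_fintype_card, Fintype.card_subtype, Finset.sum_boole]

end

/-- Two strictly increasing lists with the same members are equal. No weight exceeds the length of
the code, so the finite range of indices loses nothing. -/
theorem nonzeroWeightDistribution_eq_map {ι : Type*} [DecidableEq F] [Fintype ι]
    [Finite F] (C : Submodule F (ι → F)) {K : ℕ} {w : ℕ → ℕ}
    (hw : ∀ i j, i < j → j < K → w i < w j) (hC : ∀ i, weightCount C i ≠ 0 ↔ ∃ j < K, w j = i) :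
    nonzeroWeightDistribution C = (List.range K).map fun j => weightCount C (w j) := by
  have hle : ∀ i, weightCount C i ≠ 0 → i < Fintype.card ι + 1 := by
    intro i hi
    obtain ⟨c, -, hc⟩ := (Nat.card_ne_zero.1 hi).1
    have := hammingNorm_le_card_fintype (x := c)
    omega
  rw [nonzeroWeightDistribution, weightDistribution, List.filter_map]
  have h : (List.range (Fintype.card ι + 1)).filter
      ((fun a => decide (a ≠ 0)) ∘ weightCount C) = (List.range K).map w := by
    refine List.Pairwise.eq_of_mem_iff (r := (· < ·)) (List.pairwise_lt_range.filter _) ?_ ?_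
    · rw [List.pairwise_map]
      exact List.pairwise_lt_range.imp_of_mem fun _ hb hab => hw _ _ hab (List.mem_range.1 hb)
    · intro i
      simp only [List.mem_filter, List.mem_range, Function.comp_apply, decide_eq_true_eq,
        List.mem_map, ← hC]
      exact ⟨fun h => h.2, fun h => ⟨hle i h, h⟩⟩
  rw [h, List.map_map]
  rfl

end LinearCode

open LinearCode QuadraticForm QuadraticCount in
theorem mainTheorem8 {F : Type*} [Field F] [Finite F] [DecidableEq F]
    (m : ℕ) (hm : 2 ≤ m) (hm_even : Even m)
    [Fintype (ℙ F (Fin (m + 1) → F))]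
    (r : ℙ F (Fin (m + 1) → F) → (Fin (m + 1) → F))
    (hr : ∀ P, ∃ h : r P ≠ 0, Projectivization.mk F (r P) h = P) :
    LinearCode.IsLogConcave (LinearCode.projectiveReedMuller 2 m r) := by
  obtain ⟨M, rfl⟩ := even_iff_exists_two_mul.1 hm_even
  have hq := two_le_card_real (F := F)
  have hq1 : 1 ≤ Nat.card F := Nat.card_pos
  have hlt : ∀ i j, i < j → j < 2 * M + 2 →
      weightValue (Nat.card F) M i < weightValue (Nat.card F) M j := by
    intro i j hij hj
    have h := excessValue_lt hq hij hj
    rw [← Nat.cast_lt (α := ℝ), weightValue_cast hq1, weightValue_cast hq1]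
    linarith
  have hcount : ∀ i, (weightCount (projectiveReedMuller 2 (2 * M) r) i : ℝ) =
      ∑ j ∈ Finset.range (2 * M + 2), excessCount (Nat.card F) M j *
        if weightValue (Nat.card F) M j = i then 1 else 0 := by
    intro i
    -- The distribution of the excess is applied to the indicator function of weight `i`.
    rw [weightCount_projectiveReedMuller_two hr,
      sum_excess (2 * M + 1) (M + 1) (by omega)
        (fun e => if (Nat.card F : ℝ) ^ (2 * M) - e = i then 1 else 0),
      formSum_eq_sum_excessCount hq]
    simp only [← weightValue_cast hq1, Nat.cast_inj]
  have hvalue : ∀ j < 2 * M + 2, (weightCount (projectiveReedMuller 2 (2 * M) r)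
      (weightValue (Nat.card F) M j) : ℝ) = excessCount (Nat.card F) M j := by
    intro j hj
    rw [hcount, Finset.sum_eq_single_of_mem j (Finset.mem_range.2 hj)]
    · simp
    · intro i hi hij
      have hi := Finset.mem_range.1 hi
      rcases lt_or_gt_of_ne hij with h | h
      · rw [if_neg (hlt i j h hj).ne, mul_zero]
      · rw [if_neg (hlt j i h hi).ne', mul_zero]
  have hsupp : ∀ i, weightCount (projectiveReedMuller 2 (2 * M) r) i ≠ 0 ↔
      ∃ j < 2 * M + 2, weightValue (Nat.card F) M j = i := by
    intro i
    constructor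
    · intro hi
      by_contra! hne
      apply hi
      have h := hcount i
      rw [Finset.sum_eq_zero fun j hj => by
        rw [if_neg (hne j (Finset.mem_range.1 hj)), mul_zero]] at h
      exact_mod_cast h
    · rintro ⟨j, hj, rfl⟩ h0
      have h := hvalue j hj
      rw [h0, Nat.cast_zero] at h
      exact (excessCount_pos hq hj).ne h
  rw [IsLogConcave, nonzeroWeightDistribution_eq_map _ hlt hsupp]
  intro i hi
  have hi' : i + 2 < 2 * M + 2 := by simpa using hi
  simp only [List.getElem_map, List.getElem_range]
  rw [hvalue _ (by omega), hvalue _ (by omega), hvalue _ (by omega)]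
  exact excessCount_logConcave hq (by omega) hi'
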